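/- Let $d\ge 1$ and $0<r_{\min}\le r_{\max}<1$. Let $S_d$ be the set of similarities $f:\mathbb{R}^d\to\mathbb{R}^d$, $|f(x)-f(y)|=r_f|x-y|$, with ratio $r_f\in[r_{\min},r_{\max}]$ that map the closed unit ball into itself, with the Borel $\sigma$-algebra of the topology of pointwise convergence, and let $\Lambda=\bigsqcup_{k\ge1}S_d^k$ with its natural $\sigma$-algebra. An element $\lambda=(f_\lambda^1,\dots,f_\lambda^{N_\lambda})\in\Lambda$ has $N_\lambda$ maps, with ratios $r_\lambda^1,\dots,r_\lambda^{N_\lambda}$. Let $\mathbb{P}_1$ be a probability measure on $\Lambda$ and let $\omega=(\omega_1,\omega_2,\dots)$ have law $\mathbb{P}=\mathbb{P}_1^{\mathbb{N}}$. For $v\in\Sigma(\omega)=\prod_{i\ge1}\{1,\dots,N_{\omega_i}\}$ put $f_\omega^{v|_n}=f_{\omega_1}^{v_1}\circ\dots\circ f_{\omega_n}^{v_n}$ and $r_\omega^{v|_n}=r_{\omega_1}^{v_1}\cdots r_{\omega_n}^{v_n}$. The random homogeneous ($1$-variable) self-similar attractor is $$F_\omega=\Big\{\lim_{n\to\infty}f_\omega^{v|_n}(0):v\in\Sigma(\omega)\Big\}.$$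 For compact $K\subset\mathbb{R}^d$ let $\langle K\rangle_\varepsilon$ be its closed $\varepsilon$-neighbourhood and $\mathcal{L}^d$ Lebesgue measure. The Minkowski dimension of $K$ is the number $s$, if there is one, such that $\varepsilon^{t-d}\mathcal{L}^d(\langle K\rangle_\varepsilon)$ tends, as $\varepsilon\to0$, to $\infty$ for all $t<s$ and to $0$ for all $t>s$; $K$ is Minkowski measurable if, for this $s$, $\varepsilon^{s-d}\mathcal{L}^d(\langle K\rangle_\varepsilon)$ converges to a limit in $(0,\infty)$. Assume: (i) (uniform cylinder separation condition) there are $\gamma>0$ and $x_0\in\mathbb{R}^d$ such that for $\mathbb{P}$-almost all $\omega$ and all $v,w\in\Sigma(\omega)$, $n,m\ge1$ with $v|_n\ne w|_m$, $$|f_\omega^{v|_n}(x_0)-f_\omega^{w|_m}(x_0)|\ge\gamma\min\{r_\omega^{v|_n},r_\omega^{w|_m}\};$$ (ii) (not almost deterministic) there is no $t\in\mathbb{R}$ with $\sum_{i=1}^{N_\lambda}(r_\lambda^i)^t=1$ for $\mathbb{P}_1$-almost all $\lambda$; (iii) $2\le\operatorname{ess\,sup}_{\lambda\sim\mathbb{P}_1}N_\lambda<\infty$.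 Then there is a number $s$, the almost sure Minkowski dimension, such that almost surely $F_\omega$ has Minkowski dimension $s$; and for this $s$, almost surely, $$\limsup_{\varepsilon\to0}\varepsilon^{s-d}\mathcal{L}^d(\langle F_\omega\rangle_\varepsilon)=\infty \quad\text{and}\quad \limsup_{\delta\to0}\frac1{|\log\delta|}\int_\delta^1\varepsilon^{s-d}\mathcal{L}^d(\langle F_\omega\rangle_\varepsilon)\frac{1}{\varepsilon}\,d\varepsilon=\infty.$$ In particular, almost surely $F_\omega$ is not Minkowski measurable and does not have finite average Minkowski content, that is, the expression inside the second upper limit does not converge to a finite limit as $\delta\to0$. -/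

import Mathlib

open MeasureTheory Filter Topology
open scoped ENNReal

noncomputable section

/-! ## Minkowski content -/

namespace Minkowski

/-- The rescaled volume `ε ^ (s - d) * 𝓛ᵈ(⟨K⟩_ε)` of the closed `ε`-neighbourhood of `K ⊆ ℝᵈ`. -/
def scaledVolume {d : ℕ} (K : Set (EuclideanSpace ℝ (Fin d))) (s ε : ℝ) : ℝ≥0∞ :=
  ENNReal.ofReal (ε ^ (s - (d : ℝ))) * volume (Metric.cthickening ε K)

/-- The upper `s`-dimensional Minkowski content. -/
def upperContent {d : ℕ} (K : Set (EuclideanSpace ℝ (Fin d))) (s : ℝ) : ℝ≥0∞ :=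
  limsup (fun ε : ℝ => scaledVolume K s ε) (𝓝[>] 0)

/-- `K` has Minkowski dimension `s`: the value `s` is the critical exponent at which the
`t`-dimensional Minkowski content drops from `∞` (for `t < s`) to `0` (for `t > s`). -/
def HasDim {d : ℕ} (K : Set (EuclideanSpace ℝ (Fin d))) (s : ℝ) : Prop :=
  (∀ t : ℝ, t < s → Tendsto (fun ε : ℝ => scaledVolume K t ε) (𝓝[>] 0) (𝓝 ∞)) ∧
  (∀ t : ℝ, s < t → Tendsto (fun ε : ℝ => scaledVolume K t ε) (𝓝[>] 0) (𝓝 0))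

/-- `K` is Minkowski measurable: at its Minkowski dimension, the Minkowski content exists as a
limit and is positive and finite. -/
def IsMeasurable {d : ℕ} (K : Set (EuclideanSpace ℝ (Fin d))) : Prop :=
  ∃ s : ℝ, HasDim K s ∧ ∃ c : ℝ≥0∞, 0 < c ∧ c < ∞ ∧
    Tendsto (fun ε : ℝ => scaledVolume K s ε) (𝓝[>] 0) (𝓝 c)

/-- The logarithmic average
`|log δ|⁻¹ * ∫ ε in δ..1, ε ^ (s - d) * 𝓛ᵈ(⟨K⟩_ε) * ε⁻¹`. -/
def logAverage {d : ℕ} (K : Set (EuclideanSpace ℝ (Fin d))) (s δ : ℝ) : ℝ≥0∞ :=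
  ENNReal.ofReal (1 / |Real.log δ|) *
    ∫⁻ ε in Set.Ioc δ 1, scaledVolume K s ε * ENNReal.ofReal (1 / ε)

/-- The upper average `s`-dimensional Minkowski content. -/
def upperAverageContent {d : ℕ} (K : Set (EuclideanSpace ℝ (Fin d))) (s : ℝ) : ℝ≥0∞ :=
  limsup (fun δ : ℝ => logAverage K s δ) (𝓝[>] 0)

/-- The average `s`-dimensional Minkowski content exists (as a limit) and is finite. -/
def HasFiniteAverageContent {d : ℕ} (K : Set (EuclideanSpace ℝ (Fin d))) (s : ℝ) : Prop :=
  ∃ c : ℝ≥0∞, c < ∞ ∧ Tendsto (fun δ : ℝ => logAverage K s δ) (𝓝[>] 0) (𝓝 c)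

end Minkowski

/-! ## Random homogeneous iterated function systems -/

namespace RIFS

/-- The set `S_d` of similarities of `ℝᵈ` with contraction ratio in `[rmin, rmax]` that map the
closed unit ball into itself. -/
def Sim (d : ℕ) (rmin rmax : ℝ) : Type :=
  {f : EuclideanSpace ℝ (Fin d) → EuclideanSpace ℝ (Fin d) //
    (∃ r : ℝ, rmin ≤ r ∧ r ≤ rmax ∧ ∀ x y, dist (f x) (f y) = r * dist x y) ∧
    Set.MapsTo f (Metric.closedBall 0 1) (Metric.closedBall 0 1)}

variable {d : ℕ} {rmin rmax : ℝ}

/-- The topology of pointwise convergence. -/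
instance : TopologicalSpace (Sim d rmin rmax) :=
  inferInstanceAs (TopologicalSpace (Subtype _))

/-- The Borel `σ`-algebra of the topology of pointwise convergence. -/
instance : MeasurableSpace (Sim d rmin rmax) := borel _

instance : BorelSpace (Sim d rmin rmax) := ⟨rfl⟩

/-- The contraction ratio of a similarity (unique as soon as `d ≥ 1`). -/
def Sim.ratio (f : Sim d rmin rmax) : ℝ := Classical.choose f.2.1

theorem Sim.ratio_spec (f : Sim d rmin rmax) :
    rmin ≤ f.ratio ∧ f.ratio ≤ rmax ∧
      ∀ x y, dist (f.1 x) (f.1 y) = f.ratio * dist x y :=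
  Classical.choose_spec f.2.1

/-- The disjoint union `Λ` of the powers `S_d ^ k`, `k ≥ 1`, with its natural `σ`-algebra
(a set is measurable iff its trace on every `S_d ^ k` is); the tuples of length `k + 1` carry the
label `k`. -/
abbrev Systems (d : ℕ) (rmin rmax : ℝ) : Type :=
  Σ k : ℕ, (Fin (k + 1) → Sim d rmin rmax)

/-- The number `N_λ` of maps of `λ`. -/
def numMaps (l : Systems d rmin rmax) : ℕ := l.1 + 1

/-- The map `f_λ ^ i`. -/
def map (l : Systems d rmin rmax) (i : Fin (numMaps l)) : Sim d rmin rmax := l.2 i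

/-- The Hutchinson sum `∑ i, (r_λ ^ i) ^ s`. -/
def hutchinsonSum (l : Systems d rmin rmax) (s : ℝ) : ℝ :=
  ∑ i : Fin (numMaps l), (map l i).ratio ^ s

/-- The law `ℙ = ℙ₁ ^ ℕ` of the sequence `ω` of independent systems with common law `ℙ₁`. -/
abbrev law (P₁ : Measure (Systems d rmin rmax)) [IsProbabilityMeasure P₁] :
    Measure (ℕ → Systems d rmin rmax) :=
  Measure.infinitePi (fun _ : ℕ => P₁)

/-- The infinite codings `Σ(ω)`. -/
abbrev Coding (ω : ℕ → Systems d rmin rmax) : Type := (i : ℕ) → Fin (numMaps (ω i))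

/-- The map `f_ω ^ (v|ₙ)`, the composition of the first `n` maps chosen by `v`, where the map of
the first level is applied last. -/
def wordMap (ω : ℕ → Systems d rmin rmax) (v : Coding ω) :
    ℕ → EuclideanSpace ℝ (Fin d) → EuclideanSpace ℝ (Fin d)
  | 0 => id
  | n + 1 => wordMap ω v n ∘ (map (ω n) (v n)).1

/-- The product of the ratios of the first `n` maps chosen by `v`. -/
def wordRatio (ω : ℕ → Systems d rmin rmax) (v : Coding ω) (n : ℕ) : ℝ :=
  ∏ i ∈ Finset.range n, (map (ω i) (v i)).ratio

/-- The homogeneous attractor `F_ω`: all limits of `f_ω ^ (v|ₙ) (0)`, for `v` in `Σ(ω)`. -/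
def attractor (ω : ℕ → Systems d rmin rmax) : Set (EuclideanSpace ℝ (Fin d)) :=
  {x | ∃ v : Coding ω, Tendsto (fun n => wordMap ω v n 0) atTop (𝓝 x)}

/-- The uniform cylinder separation condition. The negated conjunction says that the finite words
`v|ₙ` and `w|ₘ` are different. -/
def UniformCylinderSeparation (P₁ : Measure (Systems d rmin rmax)) [IsProbabilityMeasure P₁] :
    Prop :=
  ∃ γ : ℝ, 0 < γ ∧ ∃ x₀ : EuclideanSpace ℝ (Fin d), ∀ᵐ ω ∂(law P₁),
    ∀ v w : Coding ω, ∀ n m : ℕ, 1 ≤ n → 1 ≤ m →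
      ¬ (n = m ∧ ∀ i < n, v i = w i) →
      γ * min (wordRatio ω v n) (wordRatio ω w m) ≤ dist (wordMap ω v n x₀) (wordMap ω w m x₀)

/-- The system is almost deterministic. -/
def AlmostDeterministic (P₁ : Measure (Systems d rmin rmax)) : Prop :=
  ∃ s : ℝ, ∀ᵐ l ∂P₁, hutchinsonSum l s = 1

/-- The essential supremum of the number of maps. -/
def essSupNumMaps (P₁ : Measure (Systems d rmin rmax)) : ℕ∞ :=
  essSup (fun l => (numMaps l : ℕ∞)) P₁

end RIFS

end

/-! Write `S_n(t)` for the walk `logWalk ω t n`, a sum of i.i.d. terms `log ∑ i, (r^i)^t`. At every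
level the numbers `r^t / hutchinsonSum` form a probability vector. A scale `ε` determines a cut of
the coding tree: stop each word once its ratio is at most `ε`. The product weights of the stopped
words `u` add up to 1, that is, `∑ r_u^t exp(-S_{|u|}(t)) = 1`. Since `r_u` is comparable to `ε`,
the number of stopped words times `ε^t` lies, up to constants, between the exponentials of any lower
and any upper bound for `S_n(t)` over the lengths `n` with `rmin^n ≤ ε < rmax^(n-1)` (`exists_cut`).
Covering by balls and, through separation, packing balls turn this count into bounds for the
rescaled volume (`scaledVolume_le`, `le_scaledVolume`).

By the strong law `S_n(t)/n` tends to `pressure t`. The pressure is strictly decreasing on `[0, ∞)`,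
and its zero `s` is the almost sure dimension. At `s` the walk is centred, and it is nondegenerate
because the system is not almost deterministic. The central limit theorem, Kolmogorov's inequality
and the zero-one law show that for each fixed `K` it exceeds any level throughout infinitely many
windows `[n, K n]` (`ae_frequently_window`). With `K = 2 q` and `rmax^q ≤ rmin`, such a window
controls all scales between `C rmin^(2n)` and `C rmin^n`. This makes the upper content infinite; and
since these scales fill at least half of `[C rmin^(2n), 1]` logarithmically, the upper average
content is infinite too (`contents_eq_top_of_frequently_window`). -/

/-! ### Long high excursions of a centred random walk. -/

namespace RandomWalk

open ProbabilityTheory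

variable {Ω : Type*} [mΩ : MeasurableSpace Ω] {μ : Measure Ω} {X : ℕ → Ω → ℝ}

/-- The increment of the square is `2 S X + X ^ 2` with `X` the next step; the cross term has
conditional mean zero by independence and centring. -/
theorem submartingale_sq_sum (hm : ∀ i, StronglyMeasurable (X i)) (h2 : ∀ i, MemLp (X i) 2 μ)
    (hindep : iIndepFun X μ) (h0 : ∀ i, ∫ ω, X i ω ∂μ = 0) :
    Submartingale (fun n ω => (∑ i ∈ Finset.range (n + 1), X i ω) ^ 2)
      (Filtration.natural X hm) μ := by
  have : IsProbabilityMeasure μ := hindep.isProbabilityMeasure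
  have hL : ∀ n, MemLp (fun ω => ∑ i ∈ Finset.range n, X i ω) 2 μ :=
    fun n => memLp_finsetSum _ fun i _ => h2 i
  have hS : ∀ n, StronglyMeasurable[Filtration.natural X hm n]
      (fun ω => ∑ i ∈ Finset.range (n + 1), X i ω) := fun n =>
    Finset.stronglyMeasurable_fun_sum _ fun i hi =>
      (Filtration.stronglyAdapted_natural hm i).mono
        ((Filtration.natural X hm).mono (Nat.lt_succ_iff.1 (Finset.mem_range.1 hi)))
  refine submartingale_of_condExp_sub_nonneg_nat (fun n => (hS n).pow 2)
    (fun n => (hL _).integrable_sq) fun n => ?_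
  have hdiff : (fun ω => (∑ i ∈ Finset.range (n + 1 + 1), X i ω) ^ 2) -
      (fun ω => (∑ i ∈ Finset.range (n + 1), X i ω) ^ 2) =
      (fun ω => 2 * ∑ i ∈ Finset.range (n + 1), X i ω) * X (n + 1) + fun ω => X (n + 1) ω ^ 2 := by
    ext ω
    simp only [Pi.sub_apply, Pi.add_apply, Pi.mul_apply, Finset.sum_range_succ _ (n + 1)]
    ring
  rw [hdiff]
  have hi1 : Integrable ((fun ω => 2 * ∑ i ∈ Finset.range (n + 1), X i ω) * X (n + 1)) μ :=
    ((hL (n + 1)).const_mul 2).integrable_mul (h2 (n + 1))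
  refine EventuallyLE.trans_eq ?_ (condExp_add hi1 (h2 (n + 1)).integrable_sq _).symm
  have h1 := condExp_mul_of_stronglyMeasurable_left (m := Filtration.natural X hm n)
    ((hS n).const_mul 2) hi1 ((h2 (n + 1)).integrable one_le_two)
  have h3 := hindep.condExp_natural_ae_eq_of_lt hm n.lt_succ_self
  have h4 : 0 ≤ᵐ[μ] μ[fun ω => X (n + 1) ω ^ 2 | Filtration.natural X hm n] :=
    condExp_nonneg (ae_of_all _ fun ω => sq_nonneg _)
  filter_upwards [h1, h3, h4] with ω h1 h3 h4
  simp only [Pi.add_apply, h1, Pi.mul_apply, h3, h0, mul_zero, zero_add]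
  exact h4

/-- Kolmogorov's maximal inequality for identically distributed variables. -/
theorem maximal_inequality (hm : ∀ i, Measurable (X i)) (h2 : MemLp (X 0) 2 μ)
    (hindep : iIndepFun X μ) (hident : ∀ i, IdentDistrib (X i) (X 0) μ μ)
    (h0 : ∫ ω, X 0 ω ∂μ = 0) {a : ℝ} (ha : 0 ≤ a) (n : ℕ) :
    ENNReal.ofReal (a ^ 2) * μ {ω | ∃ k ≤ n, a ≤ |∑ i ∈ Finset.range k, X i ω|} ≤
      ENNReal.ofReal (n * Var[X 0; μ]) := by
  have : IsProbabilityMeasure μ := hindep.isProbabilityMeasure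
  rcases n with _ | n
  · rcases ha.eq_or_lt with rfl | ha
    · simp
    · have : {ω : Ω | ∃ k ≤ 0, a ≤ |∑ i ∈ Finset.range k, X i ω|} = ∅ := by
        ext ω; simpa using ha
      rw [this]; simp
  have h2' : ∀ i, MemLp (X i) 2 μ := fun i => (hident i).memLp_iff.2 h2
  have h0' : ∀ i, ∫ ω, X i ω ∂μ = 0 := fun i => (hident i).integral_eq.trans h0
  have hL : MemLp (fun ω => ∑ i ∈ Finset.range (n + 1), X i ω) 2 μ :=
    memLp_finsetSum _ fun i _ => h2' i
  rcases ha.eq_or_lt with rfl | ha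
  · simp
  -- Doob's inequality for the squared walk at level `a ^ 2`; its time `n` is the sum of `n + 1`
  -- steps, which is why `n = 0` was treated apart.
  have key := maximal_ineq (submartingale_sq_sum (fun i => (hm i).stronglyMeasurable) h2' hindep h0')
    (fun n ω => sq_nonneg _) (ε := (a ^ 2).toNNReal) n
  have hvar : ∫ ω, (∑ i ∈ Finset.range (n + 1), X i ω) ^ 2 ∂μ = (n + 1 : ℕ) * Var[X 0; μ] := by
    have h5 := IndepFun.variance_sum (μ := μ) (X := X) (s := Finset.range (n + 1))
      (fun i _ => h2' i) (fun i _ j _ hij => hindep.indepFun hij)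
    rw [Finset.sum_congr rfl fun i _ => (hident i).variance_eq] at h5
    simp only [Finset.sum_const, Finset.card_range, nsmul_eq_mul] at h5
    rw [← h5, variance_of_integral_eq_zero]
    · simp
    · exact Finset.aemeasurable_sum _ fun i _ => (hm i).aemeasurable
    · simp only [Finset.sum_apply]
      rw [integral_finsetSum _ fun i _ => (h2' i).integrable one_le_two]
      simp [h0']
  rw [Real.coe_toNNReal _ (sq_nonneg a)] at key
  calc _ ≤ ENNReal.ofReal (a ^ 2) * μ {ω | a ^ 2 ≤ (Finset.range (n + 1)).sup'
            Finset.nonempty_range_add_one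
            fun k => (∑ i ∈ Finset.range (k + 1), X i ω) ^ 2} := by
        gcongr
        rename_i ω
        rintro ⟨k, hk, hak⟩
        rcases k with _ | k
        · simp at hak; linarith
        · refine le_trans ?_ (Finset.le_sup' (f := fun k => (∑ i ∈ Finset.range (k + 1), X i ω) ^ 2)
            (Finset.mem_range.2 hk))
          rw [← sq_abs (∑ i ∈ Finset.range (k + 1), X i ω)]
          gcongr
    _ ≤ _ := key
    _ ≤ _ := by
        rw [← hvar]
        exact ENNReal.ofReal_le_ofReal
          (setIntegral_le_integral hL.integrable_sq (ae_of_all _ fun ω => sq_nonneg _))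

end RandomWalk

namespace RandomWalk

open ProbabilityTheory

variable {Ω : Type*} [mΩ : MeasurableSpace Ω] {μ : Measure Ω} {X : ℕ → Ω → ℝ}

/-- By the central limit theorem, a centred random walk exceeds any multiple of `√n` with
probability bounded below. -/
theorem exists_le_measure_mul_sqrt_le (h2 : MemLp (X 0) 2 μ)
    (hindep : iIndepFun X μ) (hident : ∀ i, IdentDistrib (X i) (X 0) μ μ)
    (h0 : ∫ ω, X 0 ω ∂μ = 0) (hv : Var[X 0; μ] ≠ 0) (x : ℝ) :
    ∃ p : ℝ≥0∞, 0 < p ∧ ∀ᶠ n : ℕ in atTop,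
      p ≤ μ {ω | x * √n ≤ ∑ i ∈ Finset.range n, X i ω} := by
  have : IsProbabilityMeasure μ := hindep.isProbabilityMeasure
  set v := Var[X 0; μ].toNNReal with hvdef
  have hv0 : v ≠ 0 := by
    rw [hvdef, Ne, Real.toNNReal_eq_zero, not_le]
    exact lt_of_le_of_ne (variance_nonneg _ _) hv.symm
  have clt := tendstoInDistribution_inv_sqrt_mul_sum_sub (Y := id) (P := μ)
    (P' := gaussianReal 0 v) ⟨aemeasurable_id, Measure.map_id⟩ h2 hindep hident
  -- Portmanteau for an open half-line, which a nondegenerate Gaussian charges; any `p` strictly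
  -- below its mass will do.
  have hlim := ProbabilityMeasure.le_liminf_measure_open_of_tendsto clt.tendsto (isOpen_Ioi (a := x))
  have hpos : 0 < gaussianReal 0 v (Set.Ioi x) := by
    refine pos_iff_ne_zero.2 fun h => ?_
    have := gaussianReal_absolutelyContinuous' 0 hv0 h
    simp at this
  obtain ⟨p, hp0, hp⟩ := exists_between hpos
  refine ⟨p, hp0, ?_⟩
  have hlt : p < liminf (fun n : ℕ => (μ.map fun ω => (√n)⁻¹ *
      (∑ k ∈ Finset.range n, X k ω - n * ∫ ω, X 0 ω ∂μ)) (Set.Ioi x)) atTop := by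
    refine hp.trans_le (le_trans ?_ hlim)
    simp
  filter_upwards [eventually_lt_of_lt_liminf hlt, eventually_gt_atTop 0] with n hn hn0
  rw [Measure.map_apply_of_aemeasurable (clt.forall_aemeasurable n) measurableSet_Ioi] at hn
  refine hn.le.trans (measure_mono fun ω hω => ?_)
  have hs : 0 < √(n : ℝ) := Real.sqrt_pos.2 (by exact_mod_cast hn0)
  simp only [Set.mem_preimage, Set.mem_Ioi, h0, mul_zero, sub_zero] at hω
  rw [← div_eq_inv_mul, lt_div_iff₀ hs] at hω
  exact hω.le

/-- Serves both the independence of past and future blocks and the membership of an event in the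
tail `σ`-algebra. -/
theorem measurable_sum_iSup_comap {Ω : Type*} (X : ℕ → Ω → ℝ) (T : Set ℕ) {ι : Type*} (s : Finset ι)
    (e : ι → ℕ) (h : ∀ i ∈ s, e i ∈ T) :
    Measurable[⨆ i ∈ T, MeasurableSpace.comap (X i) inferInstance] fun ω => ∑ i ∈ s, X (e i) ω :=
  Finset.measurable_fun_sum _ fun i hi => Measurable.mono (comap_measurable (X (e i)))
    (le_iSup₂_of_le (e i) (h i hi) le_rfl) le_rfl

/-- A centred random walk stays, with probability bounded below, above `√n` during all of the
time window `[n, K n]`. -/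
theorem exists_le_measure_window (hm : ∀ i, Measurable (X i)) (h2 : MemLp (X 0) 2 μ)
    (hindep : iIndepFun X μ) (hident : ∀ i, IdentDistrib (X i) (X 0) μ μ)
    (h0 : ∫ ω, X 0 ω ∂μ = 0) (hv : Var[X 0; μ] ≠ 0) (K : ℕ) :
    ∃ p : ℝ≥0∞, 0 < p ∧ ∀ᶠ n : ℕ in atTop,
      p ≤ μ {ω | ∀ k, n ≤ k → k ≤ K * n → √n ≤ ∑ i ∈ Finset.range k, X i ω} := by
  have : IsProbabilityMeasure μ := hindep.isProbabilityMeasure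
  have hv0 : 0 ≤ Var[X 0; μ] := variance_nonneg _ _
  -- Chosen so that `y ^ 2 ≥ 2 K Var`: Kolmogorov's bound over `K n` steps then gives a deviation of
  -- `y √n` probability at most `1/2`.
  set y : ℝ := √(2 * K * Var[X 0; μ]) + 1 with hy
  have hy1 : 1 ≤ y := le_add_of_nonneg_left (Real.sqrt_nonneg _)
  have hy2 : 2 * (K * Var[X 0; μ]) ≤ y ^ 2 := by
    have h := Real.sq_sqrt (show 0 ≤ 2 * K * Var[X 0; μ] by positivity)
    nlinarith [Real.sqrt_nonneg (2 * K * Var[X 0; μ])]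
  obtain ⟨p, hp0, hp⟩ := exists_le_measure_mul_sqrt_le h2 hindep hident h0 hv (2 * y)
  refine ⟨p * 2⁻¹, by simp [hp0], ?_⟩
  filter_upwards [hp, eventually_gt_atTop 0] with n hn hn0
  have hs : 0 < √(n : ℝ) := Real.sqrt_pos.2 (by exact_mod_cast hn0)
  -- `A` puts the walk at `2 y √n` at time `n`; outside `B`, which depends only on later steps, it
  -- loses less than `y √n` afterwards and stays above `y √n ≥ √n`.
  set A := {ω | 2 * y * √n ≤ ∑ i ∈ Finset.range n, X i ω} with hA
  set B := {ω | ∃ k ≤ K * n, y * √n ≤ |∑ i ∈ Finset.range k, X (n + i) ω|} with hB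
  have hBm : MeasurableSet[⨆ i ∈ Set.Ici n, MeasurableSpace.comap (X i) inferInstance] B := by
    have : B = ⋃ k, ⋃ (_ : k ≤ K * n), {ω | y * √n ≤ |∑ i ∈ Finset.range k, X (n + i) ω|} := by
      ext; simp [hB]
    rw [this]
    refine MeasurableSet.iUnion fun k => MeasurableSet.iUnion fun _ => ?_
    have hk := measurable_sum_iSup_comap X (Set.Ici n) (Finset.range k) (fun i => n + i)
      fun i _ => Nat.le_add_right n i
    exact measurableSet_le measurable_const (measurable_abs.comp hk)
  have hAm : MeasurableSet[⨆ i ∈ Set.Iio n, MeasurableSpace.comap (X i) inferInstance] A :=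
    measurableSet_le measurable_const (measurable_sum_iSup_comap X (Set.Iio n) (Finset.range n)
      (fun i => i) fun i hi => Finset.mem_range.1 hi)
  have hle : ∀ i, MeasurableSpace.comap (X i) inferInstance ≤ mΩ := fun i => (hm i).comap_le
  have hind := indep_iSup_of_disjoint hle hindep
    (S := Set.Iio n) (T := Set.Ici n) (Set.disjoint_left.2 fun i hi hi' =>
      not_lt.2 (Set.mem_Ici.1 hi') (Set.mem_Iio.1 hi))
  have hBΩ : MeasurableSet B := (iSup₂_le fun i _ => hle i) _ hBm
  have hAB : μ (A ∩ Bᶜ) = μ A * μ Bᶜ := (Indep_iff _ _ _).1 hind _ _ hAm hBm.compl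
  have hB2 : 2⁻¹ ≤ μ Bᶜ := by
    have hident' : ∀ i, IdentDistrib (X (n + i)) (X (n + 0)) μ μ :=
      fun i => (hident _).trans (hident _).symm
    have key := maximal_inequality (X := fun i => X (n + i)) (fun i => hm _)
      ((hident _).memLp_iff.2 h2) (hindep.precomp (add_right_injective n)) hident'
      ((hident _).integral_eq.trans h0) (a := y * √n) (by positivity) (K * n)
    change _ * μ B ≤ _ at key
    rw [(hident _).variance_eq] at key
    have hB3 : μ B ≤ 2⁻¹ := by
      have hpos : 0 < (y * √n) ^ 2 := by positivity
      have h6 : ENNReal.ofReal ((K * n : ℕ) * Var[X 0; μ]) ≤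
          ENNReal.ofReal ((y * √n) ^ 2) * 2⁻¹ := by
        rw [show (2⁻¹ : ℝ≥0∞) = ENNReal.ofReal 2⁻¹ by
          rw [ENNReal.ofReal_inv_of_pos two_pos]; simp, ← ENNReal.ofReal_mul hpos.le]
        refine ENNReal.ofReal_le_ofReal ?_
        rw [mul_pow, Real.sq_sqrt (Nat.cast_nonneg n)]
        push_cast
        nlinarith [show (0 : ℝ) ≤ n from Nat.cast_nonneg n]
      exact (ENNReal.mul_le_mul_iff_right (by simpa using hpos.ne')
        ENNReal.ofReal_ne_top).1 (key.trans h6)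
    rw [prob_compl_eq_one_sub hBΩ, ← ENNReal.one_sub_inv_two]
    exact tsub_le_tsub_left hB3 _
  calc p * 2⁻¹ ≤ μ A * μ Bᶜ := mul_le_mul' hn hB2
    _ = μ (A ∩ Bᶜ) := hAB.symm
    _ ≤ _ := measure_mono ?_
  rintro ω ⟨h1, h3⟩ k hk1 hk2
  obtain ⟨j, rfl⟩ := Nat.exists_eq_add_of_le hk1
  have h4 : |∑ i ∈ Finset.range j, X (n + i) ω| < y * √n := by
    by_contra! h
    exact h3 ⟨j, by omega, h⟩
  have h5 := (abs_lt.1 h4).1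
  rw [Finset.sum_range_add]
  have h1' : 2 * y * √n ≤ ∑ i ∈ Finset.range n, X i ω := h1
  nlinarith

/-- Continuity from above along the decreasing unions of the tails `n ≥ m`. -/
theorem le_measure_frequently [IsFiniteMeasure μ] {B : ℕ → Set Ω} (hB : ∀ n, MeasurableSet (B n))
    {p : ℝ≥0∞} (h : ∀ᶠ n in atTop, p ≤ μ (B n)) : p ≤ μ {ω | ∃ᶠ n in atTop, ω ∈ B n} := by
  have : {ω | ∃ᶠ n in atTop, ω ∈ B n} = ⋂ m : ℕ, ⋃ n ≥ m, B n := by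
    ext ω; simp [frequently_atTop]
  rw [this]
  have hanti : Antitone fun m : ℕ => ⋃ n ≥ m, B n := fun a b hab =>
    Set.biUnion_subset_biUnion_left fun n hn => le_trans hab hn
  refine ge_of_tendsto (tendsto_measure_iInter_atTop (fun m => (MeasurableSet.biUnion
    (Set.to_countable _) fun n _ => hB n).nullMeasurableSet) hanti ⟨0, measure_ne_top _ _⟩) ?_
  refine Eventually.of_forall fun m => ?_
  obtain ⟨n, hn, hmn⟩ := (h.and (eventually_ge_atTop m)).exists
  exact hn.trans (measure_mono (Set.subset_biUnion_of_mem (u := B) hmn))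

/-- Almost surely, a nondegenerate centred random walk is, for infinitely many `n`, arbitrarily
large during all of the time window `[n, K n]`. -/
theorem ae_frequently_window (hm : ∀ i, Measurable (X i)) (h2 : MemLp (X 0) 2 μ)
    (hindep : iIndepFun X μ) (hident : ∀ i, IdentDistrib (X i) (X 0) μ μ)
    (h0 : ∫ ω, X 0 ω ∂μ = 0) (hv : Var[X 0; μ] ≠ 0) (K : ℕ) :
    ∀ᵐ ω ∂μ, ∀ M : ℝ, ∃ᶠ n : ℕ in atTop, ∀ k, n ≤ k → k ≤ K * n →
      M ≤ ∑ i ∈ Finset.range k, X i ω := by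
  have : IsProbabilityMeasure μ := hindep.isProbabilityMeasure
  obtain ⟨p, hp0, hp⟩ := exists_le_measure_window hm h2 hindep hident h0 hv K
  set E := {ω | ∀ M : ℕ, ∃ᶠ n : ℕ in atTop, ∀ k, n ≤ k → k ≤ K * n →
      (M : ℝ) ≤ ∑ i ∈ Finset.range k, X i ω} with hE
  -- Dropping the first `m` steps shifts the walk by a constant, absorbed by the arbitrary level
  -- `M`; hence `E` is a tail event.
  have hshift : ∀ m, E = {ω | ∀ M : ℕ, ∃ᶠ n : ℕ in atTop, m ≤ n ∧ ∀ k, n ≤ k → k ≤ K * n →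
      (M : ℝ) ≤ ∑ i ∈ Finset.Ico m k, X i ω} := by
    intro m
    ext ω
    obtain ⟨c, hc⟩ := exists_nat_ge |∑ i ∈ Finset.range m, X i ω|
    have hc' := abs_le.1 hc
    constructor
    · intro h M
      refine ((h (M + c)).and_eventually (eventually_ge_atTop m)).mono ?_
      rintro n ⟨h1, hn⟩
      refine ⟨hn, fun k hk1 hk2 => ?_⟩
      rw [Finset.sum_Ico_eq_sub _ (hn.trans hk1)]
      have := h1 k hk1 hk2
      push_cast at this
      linarith
    · intro h M
      refine (h (M + c)).mono ?_
      rintro n ⟨hn, h1⟩ k hk1 hk2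
      have := h1 k hk1 hk2
      rw [Finset.sum_Ico_eq_sub _ (hn.trans hk1)] at this
      push_cast at this
      linarith
  have hle : ∀ i, MeasurableSpace.comap (X i) inferInstance ≤ mΩ := fun i => (hm i).comap_le
  have htail : MeasurableSet[limsup (fun i => MeasurableSpace.comap (X i) inferInstance) atTop] E := by
    rw [limsup_eq_iInf_iSup_of_nat, MeasurableSpace.measurableSet_iInf]
    intro m
    have hrw : E = ⋂ M : ℕ, ⋂ N : ℕ, ⋃ n : ℕ, ⋃ (_ : N ≤ n ∧ m ≤ n), ⋂ k, ⋂ (_ : n ≤ k ∧ k ≤ K * n),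
        {ω | (M : ℝ) ≤ ∑ i ∈ Finset.Ico m k, X i ω} := by
      rw [hshift m]
      ext ω
      simp only [frequently_atTop, Set.mem_ofPred_eq, Set.mem_iInter, Set.mem_iUnion, and_imp,
        exists_prop, and_assoc]
    rw [hrw]
    refine MeasurableSet.iInter fun M => MeasurableSet.iInter fun N => MeasurableSet.iUnion fun n =>
      MeasurableSet.iUnion fun _ => MeasurableSet.iInter fun k => MeasurableSet.iInter fun _ =>
      measurableSet_le measurable_const ?_
    exact measurable_sum_iSup_comap X (Set.Ici m) (Finset.Ico m k) (fun i => i)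
      fun i hi => (Finset.mem_Ico.1 hi).1
  have hpE : p ≤ μ E := by
    refine (le_measure_frequently (fun n => ?_) hp).trans (measure_mono fun ω hω M => ?_)
    · have hrw : {ω | ∀ k, n ≤ k → k ≤ K * n → √n ≤ ∑ i ∈ Finset.range k, X i ω} =
          ⋂ k, ⋂ (_ : n ≤ k ∧ k ≤ K * n), {ω | √n ≤ ∑ i ∈ Finset.range k, X i ω} := by
        ext; simp
      rw [hrw]
      exact MeasurableSet.iInter fun k => MeasurableSet.iInter fun _ =>
        measurableSet_le measurable_const (Finset.measurable_fun_sum _ fun i _ => hm i)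
    · have hω' : ∃ᶠ n : ℕ in atTop, ∀ k, n ≤ k → k ≤ K * n → √n ≤ ∑ i ∈ Finset.range k, X i ω := hω
      refine (hω'.and_eventually (eventually_ge_atTop (M ^ 2))).mono ?_
      rintro n ⟨h1, hn⟩ k hk1 hk2
      refine le_trans ?_ (h1 k hk1 hk2)
      exact Real.le_sqrt_of_sq_le (by exact_mod_cast hn)
  have hE1 : μ E = 1 := (measure_zero_or_one_of_measurableSet_limsup_atTop hle hindep
    htail).resolve_left fun h => absurd (h ▸ hpE) (not_le.2 hp0)
  have hEae : ∀ᵐ ω ∂μ, ω ∈ E := by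
    have hEm : MeasurableSet E := by
      have : limsup (fun i => MeasurableSpace.comap (X i) inferInstance) atTop ≤ mΩ := by
        rw [limsup_eq_iInf_iSup_of_nat]
        exact (iInf_le _ 0).trans (iSup₂_le fun i _ => hle i)
      exact this _ htail
    exact (prob_compl_eq_zero_iff hEm).2 hE1
  filter_upwards [hEae] with ω hω M
  obtain ⟨c, hc⟩ := exists_nat_ge M
  exact (hω c).mono fun n h k hk1 hk2 => hc.trans (h k hk1 hk2)

end RandomWalk

/-! ### Stopped words and their number. -/

namespace RIFS

/-- Stopped words: a bounded stopping time on infinite words has a finite set of stopped prefixes,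
and these form a partition of the space of infinite words. -/
theorem exists_stopped_words {α : ℕ → Type*} [∀ i, Fintype (α i)] [∀ i, Nonempty (α i)]
    (τ : (∀ i, α i) → ℕ) (L : ℕ) (hL : ∀ v, τ v ≤ L)
    (hτ : ∀ v w, (∀ i < τ v, w i = v i) → τ w = τ v) :
    ∃ T : Finset (∀ i, α i), (∀ v, ∃ u ∈ T, τ u = τ v ∧ ∀ i < τ v, v i = u i) ∧
      (∀ u ∈ T, ∀ w ∈ T, (∀ i < τ u, w i = u i) → w = u) ∧
      ∀ q : ∀ i, α i → ℝ, (∀ i, ∑ j, q i j = 1) →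
        ∑ u ∈ T, ∏ i ∈ Finset.range (τ u), q i (u i) = 1 := by
  classical
  let o : ∀ i, α i := fun i => Classical.arbitrary _
  -- Letters after the stopping time are replaced by a default, so each stopped prefix has one
  -- canonical infinite representative.
  let trunc : (∀ i, α i) → ∀ i, α i := fun v i => if i < τ v then v i else o i
  let ext : (∀ i : Fin L, α i) → ∀ i, α i := fun w i => if h : i < L then w ⟨i, h⟩ else o i
  have htrunc : ∀ v, ∀ i < τ v, trunc v i = v i := fun v i hi => if_pos hi
  have hτtrunc : ∀ v, τ (trunc v) = τ v := fun v => hτ v _ (htrunc v)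
  have hext : ∀ w (i : Fin L), ext w i = w i := fun w i => by simp [ext]
  have hagree : ∀ v w, (∀ i < τ v, w i = v i) → trunc w = trunc v := by
    intro v w h
    ext i
    simp only [trunc, hτ v w h]
    split_ifs with hi
    · exact h i hi
    · rfl
  have htt : ∀ v, trunc (trunc v) = trunc v := fun v => hagree v _ (htrunc v)
  set T : Finset (∀ i, α i) := Finset.univ.image fun w => trunc (ext w) with hT
  have hTtrunc : ∀ u ∈ T, trunc u = u := by
    intro u hu
    obtain ⟨w, -, rfl⟩ := Finset.mem_image.1 hu
    exact htt _
  refine ⟨T, fun v => ?_, fun u hu w hw h => ?_, fun q hq => ?_⟩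
  · have hv : ∀ i < τ v, ext (fun i : Fin L => v i) i = v i := fun i hi =>
      hext (fun i : Fin L => v i) ⟨i, hi.trans_le (hL v)⟩
    refine ⟨_, Finset.mem_image_of_mem _ (Finset.mem_univ fun i : Fin L => v i), ?_⟩
    rw [hagree v _ hv]
    exact ⟨hτtrunc v, fun i hi => (htrunc v i hi).symm⟩
  · rw [← hTtrunc u hu, ← hTtrunc w hw]
    exact hagree u w h
  · have htotal : ∑ w : (∀ i : Fin L, α i), ∏ i : Fin L, q i (w i) = 1 := by
      have := Finset.prod_univ_sum (fun i : Fin L => (Finset.univ : Finset (α i)))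
        (fun i j => q i j)
      rw [Fintype.piFinset_univ] at this
      rw [← this]
      exact Finset.prod_eq_one fun i _ => hq i
    rw [← htotal, ← Finset.sum_fiberwise_of_maps_to (s := Finset.univ) (t := T)
      (g := fun w => trunc (ext w)) fun w hw => Finset.mem_image_of_mem _ hw]
    refine Finset.sum_congr rfl fun u hu => ?_
    -- The length-`L` words with a given stopped prefix form a box: letters before the stopping time
    -- are fixed, the others are free and contribute factors 1.
    have hfib : Finset.univ.filter (fun w => trunc (ext w) = u) =
        Fintype.piFinset (fun i : Fin L =>
          if (i : ℕ) < τ u then ({u i} : Finset (α i)) else Finset.univ) := by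
      ext w
      simp only [Finset.mem_filter, Finset.mem_univ, true_and, Fintype.mem_piFinset]
      constructor
      · intro h i
        split_ifs with hi
        · rw [Finset.mem_singleton, ← hext w i]
          subst h
          rw [hτtrunc] at hi
          exact (htrunc _ _ hi).symm
        · exact Finset.mem_univ _
      · intro h
        rw [← hTtrunc u hu]
        refine hagree u _ fun i hi => ?_
        have := h ⟨i, hi.trans_le (hL u)⟩
        rw [if_pos hi, Finset.mem_singleton] at this
        exact (hext w ⟨i, hi.trans_le (hL u)⟩).trans this
    rw [hfib, ← Finset.prod_univ_sum]
    have hfac : ∀ i : Fin L, (∑ j ∈ (if (i : ℕ) < τ u then ({u i} : Finset (α i)) else Finset.univ),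
        q i j) = if (i : ℕ) < τ u then q i (u i) else 1 := by
      intro i
      split_ifs
      · simp
      · exact hq i
    rw [Finset.prod_congr rfl fun i _ => hfac i,
      Fin.prod_univ_eq_prod_range (fun i => if i < τ u then q i (u i) else 1) L,
      Finset.prod_ite, Finset.prod_const_one, mul_one]
    refine Finset.prod_congr ?_ fun _ _ => rfl
    ext i
    simp only [Finset.mem_range, Finset.mem_filter]
    exact ⟨fun h => ⟨h.trans_le (hL u), h⟩, fun h => h.2⟩

variable {d : ℕ} {rmin rmax : ℝ}

theorem Sim.ratio_pos (hrmin : 0 < rmin) (f : Sim d rmin rmax) : 0 < f.ratio :=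
  hrmin.trans_le f.ratio_spec.1

theorem Sim.dist_eq (f : Sim d rmin rmax) (x y : EuclideanSpace ℝ (Fin d)) :
    dist (f.1 x) (f.1 y) = f.ratio * dist x y := f.ratio_spec.2.2 x y

instance (l : Systems d rmin rmax) : Nonempty (Fin (numMaps l)) := ⟨⟨0, Nat.succ_pos _⟩⟩

theorem hutchinsonSum_pos (hrmin : 0 < rmin) (l : Systems d rmin rmax) (t : ℝ) :
    0 < hutchinsonSum l t :=
  Finset.sum_pos (fun i _ => Real.rpow_pos_of_pos ((map l i).ratio_pos hrmin) t)
    Finset.univ_nonempty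

/-- The partial sums of `log ∑ i, (r_λ ^ i) ^ t` along `ω`. -/
noncomputable def logWalk (ω : ℕ → Systems d rmin rmax) (t : ℝ) (n : ℕ) : ℝ :=
  ∑ k ∈ Finset.range n, Real.log (hutchinsonSum (ω k) t)

section Words

variable {ω : ℕ → Systems d rmin rmax} (v w : Coding ω)

theorem wordMap_congr {n : ℕ} (h : ∀ i < n, w i = v i) : wordMap ω w n = wordMap ω v n := by
  induction n with
  | zero => rfl
  | succ n ih =>
    simp only [wordMap]
    rw [ih fun i hi => h i (hi.trans n.lt_succ_self), h n n.lt_succ_self]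

theorem wordRatio_congr {n : ℕ} (h : ∀ i < n, w i = v i) : wordRatio ω w n = wordRatio ω v n :=
  Finset.prod_congr rfl fun i hi => by rw [h i (Finset.mem_range.1 hi)]

theorem dist_wordMap (n : ℕ) (x y : EuclideanSpace ℝ (Fin d)) :
    dist (wordMap ω v n x) (wordMap ω v n y) = wordRatio ω v n * dist x y := by
  induction n generalizing x y with
  | zero => simp [wordMap, wordRatio]
  | succ n ih =>
    simp only [wordMap, Function.comp_apply, ih, Sim.dist_eq, wordRatio, Finset.prod_range_succ]
    ring

theorem antitone_wordMap_image :
    Antitone fun n => wordMap ω v n '' Metric.closedBall 0 1 := by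
  refine antitone_nat_of_succ_le fun n => ?_
  simp only [wordMap, Set.image_comp]
  exact Set.image_mono (map (ω n) (v n)).2.2.image_subset

theorem wordRatio_succ (n : ℕ) :
    wordRatio ω v (n + 1) = wordRatio ω v n * (map (ω n) (v n)).ratio :=
  Finset.prod_range_succ _ _

variable (hrmin : 0 < rmin)
include hrmin

theorem wordRatio_pos (n : ℕ) : 0 < wordRatio ω v n :=
  Finset.prod_pos fun _ _ => Sim.ratio_pos hrmin _

theorem pow_le_wordRatio (n : ℕ) : rmin ^ n ≤ wordRatio ω v n := by
  have := Finset.prod_le_prod (s := Finset.range n) (f := fun _ => rmin)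
    (fun _ _ => hrmin.le) fun i _ => (map (ω i) (v i)).ratio_spec.1
  simpa [wordRatio] using this

theorem wordRatio_le_pow (n : ℕ) : wordRatio ω v n ≤ rmax ^ n := by
  have := Finset.prod_le_prod (s := Finset.range n) (g := fun _ => rmax)
    (fun i _ => ((map (ω i) (v i)).ratio_pos hrmin).le) fun i _ => (map (ω i) (v i)).ratio_spec.2.1
  simpa [wordRatio] using this

theorem dist_wordMap_zero_le {n m : ℕ} (h : n ≤ m) :
    dist (wordMap ω v m 0) (wordMap ω v n 0) ≤ wordRatio ω v n := by
  obtain ⟨y, hy, hyx⟩ := antitone_wordMap_image v h (Set.mem_image_of_mem _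
    (Metric.mem_closedBall_self zero_le_one))
  rw [← hyx, dist_wordMap]
  exact mul_le_of_le_one_right (wordRatio_pos v hrmin n).le hy

theorem dist_le_wordRatio_of_tendsto {x : EuclideanSpace ℝ (Fin d)}
    (h : Tendsto (fun n => wordMap ω v n 0) atTop (𝓝 x)) (n : ℕ) :
    dist x (wordMap ω v n 0) ≤ wordRatio ω v n :=
  le_of_tendsto (h.dist tendsto_const_nhds) ((eventually_ge_atTop n).mono fun _ hm =>
    dist_wordMap_zero_le v hrmin hm)

variable (hrmax : rmax < 1)
include hrmax

theorem exists_mem_attractor :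
    ∃ x ∈ attractor ω, ∀ n, dist x (wordMap ω v n 0) ≤ wordRatio ω v n := by
  have h0 : 0 ≤ rmax := hrmin.le.trans
    ((map (ω 0) (v 0)).ratio_spec.1.trans (map (ω 0) (v 0)).ratio_spec.2.1)
  have hc : CauchySeq fun n => wordMap ω v n 0 :=
    cauchySeq_of_le_tendsto_0' (fun n => rmax ^ n) (fun n m hnm => by
      rw [dist_comm]
      exact (dist_wordMap_zero_le v hrmin hnm).trans (wordRatio_le_pow v hrmin n))
      (tendsto_pow_atTop_nhds_zero_of_lt_one h0 hrmax)
  obtain ⟨x, hx⟩ := cauchySeq_tendsto_of_complete hc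
  exact ⟨x, ⟨v, hx⟩, dist_le_wordRatio_of_tendsto v hrmin hx⟩

end Words

/-- The first length at which the ratio of a coding is at most `ε`. -/
noncomputable def cutLength (ω : ℕ → Systems d rmin rmax) (ε : ℝ) (v : Coding ω) : ℕ :=
  sInf {n | wordRatio ω v n ≤ ε}

section Stop

variable {ω : ℕ → Systems d rmin rmax} (v w : Coding ω) {ε : ℝ}

theorem cutLength_le {n : ℕ} (h : wordRatio ω v n ≤ ε) : cutLength ω ε v ≤ n := Nat.sInf_le h

theorem lt_wordRatio_of_lt_cutLength {n : ℕ} (h : n < cutLength ω ε v) : ε < wordRatio ω v n :=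
  not_le.1 (Nat.notMem_of_lt_sInf h)

variable (hrmin : 0 < rmin) (hrmax : rmax < 1) (h0 : 0 < ε)
include hrmin hrmax h0

/-- The ratios decay at least like `rmax ^ n`, so the infimum is attained and is not the default
value of `sInf ∅`. -/
theorem wordRatio_cutLength_le : wordRatio ω v (cutLength ω ε v) ≤ ε := by
  obtain ⟨n, hn⟩ := exists_pow_lt_of_lt_one h0 hrmax
  exact Nat.sInf_mem (s := {n | wordRatio ω v n ≤ ε})
    ⟨n, (wordRatio_le_pow v hrmin n).trans hn.le⟩

theorem pow_cutLength_le : rmin ^ cutLength ω ε v ≤ ε :=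
  (pow_le_wordRatio v hrmin _).trans (wordRatio_cutLength_le v hrmin hrmax h0)

theorem cutLength_congr (h : ∀ i < cutLength ω ε v, w i = v i) :
    cutLength ω ε w = cutLength ω ε v := by
  refine le_antisymm (cutLength_le w ?_) (not_lt.1 fun hlt => ?_)
  · rw [wordRatio_congr v w h]
    exact wordRatio_cutLength_le v hrmin hrmax h0
  · refine (lt_wordRatio_of_lt_cutLength v hlt).not_ge ?_
    rw [← wordRatio_congr v w fun i hi => h i (hi.trans hlt)]
    exact wordRatio_cutLength_le w hrmin hrmax h0

variable (h1 : ε < 1)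
include h1

theorem one_le_cutLength : 1 ≤ cutLength ω ε v := by
  by_contra! h
  have := wordRatio_cutLength_le v hrmin hrmax h0
  rw [Nat.lt_one_iff.1 h] at this
  simp only [wordRatio, Finset.range_zero, Finset.prod_empty] at this
  linarith

/-- One letter earlier the ratio still exceeds `ε`, and the last map costs at most a factor `rmin`.
-/
theorem mul_le_wordRatio_cutLength : rmin * ε ≤ wordRatio ω v (cutLength ω ε v) := by
  obtain ⟨n, hn⟩ := Nat.exists_eq_add_of_le' (one_le_cutLength v hrmin hrmax h0 h1)
  have h := lt_wordRatio_of_lt_cutLength v (ε := ε) (n := n) (by omega)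
  rw [hn, wordRatio_succ, mul_comm]
  exact mul_le_mul h.le (Sim.ratio_spec _).1 hrmin.le (h0.le.trans h.le)

theorem lt_pow_cutLength_sub_one : ε < rmax ^ (cutLength ω ε v - 1) :=
  (lt_wordRatio_of_lt_cutLength v (Nat.sub_lt (one_le_cutLength v hrmin hrmax h0 h1) one_pos)).trans_le
    (wordRatio_le_pow v hrmin _)

end Stop

section Count

variable (hrmin : 0 < rmin) (hrmax : rmax < 1) {ε : ℝ} (h0 : 0 < ε) (h1 : ε < 1)
include hrmin hrmax h0 h1

/-- The stopped words at scale `ε`, and the bounds on their number. -/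
theorem exists_cut (ω : ℕ → Systems d rmin rmax) :
    ∃ T : Finset (Coding ω),
      (∀ v, ∃ u ∈ T, cutLength ω ε u = cutLength ω ε v ∧ ∀ i < cutLength ω ε v, v i = u i) ∧
      (∀ u ∈ T, ∀ w ∈ T, (∀ i < cutLength ω ε u, w i = u i) → w = u) ∧
      ∀ t : ℝ, 0 ≤ t → ∀ m : ℝ,
        ((∀ n, 1 ≤ n → rmin ^ n ≤ ε → ε < rmax ^ (n - 1) → m ≤ logWalk ω t n) →
          Real.exp m ≤ T.card * ε ^ t) ∧
        ((∀ n, 1 ≤ n → rmin ^ n ≤ ε → ε < rmax ^ (n - 1) → logWalk ω t n ≤ m) →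
          T.card * (rmin * ε) ^ t ≤ Real.exp m) := by
  obtain ⟨L, hL⟩ := exists_pow_lt_of_lt_one h0 hrmax
  obtain ⟨T, hT1, hT2, hT3⟩ := exists_stopped_words (α := fun i => Fin (numMaps (ω i)))
    (cutLength ω ε) L (fun v => cutLength_le v ((wordRatio_le_pow v hrmin L).trans hL.le))
    (fun v w h => cutLength_congr v w hrmin hrmax h0 h)
  refine ⟨T, hT1, hT2, fun t ht m => ?_⟩
  -- Normalised weights: along a word the product is `wordRatio ^ t * exp (-logWalk)`, so these
  -- quantities sum to 1 over the cut.
  have hsum := hT3 (fun i j => (map (ω i) j).ratio ^ t / hutchinsonSum (ω i) t) fun i => by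
    rw [← Finset.sum_div]
    exact div_self (hutchinsonSum_pos hrmin _ t).ne'
  have hterm : ∀ u : Coding ω, ∀ n, ∏ i ∈ Finset.range n, ((map (ω i) (u i)).ratio ^ t /
      hutchinsonSum (ω i) t) = wordRatio ω u n ^ t * Real.exp (-logWalk ω t n) := by
    intro u n
    rw [Finset.prod_div_distrib, wordRatio,
      Real.finsetProd_rpow _ _ fun i _ => (Sim.ratio_pos hrmin _).le, Real.exp_neg, logWalk,
      Real.exp_sum, div_eq_mul_inv]
    congr 2
    exact Finset.prod_congr rfl fun i _ => (Real.exp_log (hutchinsonSum_pos hrmin _ t)).symm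
  simp only [hterm] at hsum
  constructor
  · intro h
    have hle : (1 : ℝ) ≤ T.card * (ε ^ t * Real.exp (-m)) := by
      rw [← hsum, ← nsmul_eq_mul]
      refine Finset.sum_le_card_nsmul _ _ _ fun u _ => ?_
      gcongr
      · exact (wordRatio_pos u hrmin _).le
      · exact wordRatio_cutLength_le u hrmin hrmax h0
      · exact h _ (one_le_cutLength u hrmin hrmax h0 h1) (pow_cutLength_le u hrmin hrmax h0)
          (lt_pow_cutLength_sub_one u hrmin hrmax h0 h1)
    rwa [← mul_assoc, Real.exp_neg, ← div_eq_mul_inv, one_le_div (Real.exp_pos m)] at hle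
  · intro h
    have hle : T.card * ((rmin * ε) ^ t * Real.exp (-m)) ≤ (1 : ℝ) := by
      rw [← hsum, ← nsmul_eq_mul]
      refine Finset.card_nsmul_le_sum _ _ _ fun u _ => ?_
      gcongr
      · exact Real.rpow_nonneg (wordRatio_pos u hrmin _).le _
      · exact mul_le_wordRatio_cutLength u hrmin hrmax h0 h1
      · exact h _ (one_le_cutLength u hrmin hrmax h0 h1) (pow_cutLength_le u hrmin hrmax h0)
          (lt_pow_cutLength_sub_one u hrmin hrmax h0 h1)
    rwa [← mul_assoc, Real.exp_neg, ← div_eq_mul_inv, div_le_one (Real.exp_pos m)] at hle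

end Count

end RIFS

/-! ### From word counts to volumes. -/

namespace RIFS
variable {d : ℕ} {rmin rmax : ℝ}

theorem volume_ball_one_pos (d : ℕ) :
    0 < (volume (Metric.ball (0 : EuclideanSpace ℝ (Fin d)) 1)).toReal :=
  ENNReal.toReal_pos (Metric.measure_ball_pos _ _ one_pos).ne' measure_ball_lt_top.ne

theorem volume_ball_eq (x : EuclideanSpace ℝ (Fin d)) {r : ℝ} (hr : 0 < r) :
    volume (Metric.ball x r) =
      ENNReal.ofReal (r ^ d * (volume (Metric.ball (0 : EuclideanSpace ℝ (Fin d)) 1)).toReal) := by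
  rw [Measure.addHaar_ball_of_pos _ _ hr, finrank_euclideanSpace_fin, ENNReal.ofReal_mul (by positivity),
    ENNReal.ofReal_toReal measure_ball_lt_top.ne]

/-- Each attractor point is within `ε` of the image of `0` under a stopped word, so balls of radius
`4 ε` around these images cover the neighbourhood. -/
theorem scaledVolume_le (hrmin : 0 < rmin) (hrmax : rmax < 1) (ω : ℕ → Systems d rmin rmax)
    {t : ℝ} (ht : 0 ≤ t) :
    ∃ c > 0, ∀ ε, 0 < ε → ε < 1 → ∀ m,
      (∀ n, 1 ≤ n → rmin ^ n ≤ ε → ε < rmax ^ (n - 1) → logWalk ω t n ≤ m) →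
      Minkowski.scaledVolume (attractor ω) t ε ≤ ENNReal.ofReal (c * Real.exp m) := by
  set κ := (volume (Metric.ball (0 : EuclideanSpace ℝ (Fin d)) 1)).toReal with hκ
  have hκ0 : 0 < κ := volume_ball_one_pos d
  have hpos : 0 < rmin ^ t := Real.rpow_pos_of_pos hrmin t
  refine ⟨4 ^ d * κ / rmin ^ t, by positivity, fun ε h0 h1 m hm => ?_⟩
  obtain ⟨T, hT1, -, hT3⟩ := exists_cut hrmin hrmax h0 h1 ω
  have hcard := (hT3 t ht m).2 hm
  have hsub : Metric.cthickening ε (attractor ω) ⊆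
      ⋃ u ∈ T, Metric.ball (wordMap ω u (cutLength ω ε u) 0) (4 * ε) := by
    intro x hx
    have hx' := Metric.cthickening_subset_thickening' (δ₂ := 2 * ε) (by linarith) (by linarith) _ hx
    obtain ⟨y, ⟨v, hv⟩, hxy⟩ := Metric.mem_thickening_iff.1 hx'
    obtain ⟨u, hu, hτ, hagree⟩ := hT1 v
    simp only [Set.mem_iUnion]
    refine ⟨u, hu, ?_⟩
    rw [Metric.mem_ball, hτ, ← wordMap_congr u v hagree]
    have h2 := (dist_le_wordRatio_of_tendsto v hrmin hv (cutLength ω ε v)).trans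
      (wordRatio_cutLength_le v hrmin hrmax h0)
    linarith [dist_triangle x y (wordMap ω v (cutLength ω ε v) 0)]
  have hvol : volume (Metric.cthickening ε (attractor ω)) ≤
      ENNReal.ofReal (T.card * ((4 * ε) ^ d * κ)) := by
    refine (measure_mono hsub).trans ((measure_biUnion_finset_le _ _).trans_eq ?_)
    rw [Finset.sum_congr rfl fun u _ => volume_ball_eq _ (by positivity), Finset.sum_const,
      ENNReal.ofReal_mul (Nat.cast_nonneg _), nsmul_eq_mul, ENNReal.ofReal_natCast]
  rw [Minkowski.scaledVolume]
  refine (mul_le_mul_right hvol _).trans ?_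
  rw [← ENNReal.ofReal_mul (by positivity)]
  refine ENNReal.ofReal_le_ofReal ?_
  rw [Real.mul_rpow hrmin.le h0.le] at hcard
  have hεt : 0 < ε ^ t := Real.rpow_pos_of_pos h0 t
  calc ε ^ (t - d) * (T.card * ((4 * ε) ^ d * κ))
      = 4 ^ d * κ / rmin ^ t * (T.card * (rmin ^ t * ε ^ t)) := by
        rw [Real.rpow_sub h0, Real.rpow_natCast, mul_pow]
        field_simp
    _ ≤ _ := by gcongr

/-- The separation condition for a fixed realization. -/
def IsSeparated (ω : ℕ → Systems d rmin rmax) (γ : ℝ) (x₀ : EuclideanSpace ℝ (Fin d)) : Prop :=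
  ∀ v w : Coding ω, ∀ n m : ℕ, 1 ≤ n → 1 ≤ m → ¬ (n = m ∧ ∀ i < n, v i = w i) →
    γ * min (wordRatio ω v n) (wordRatio ω w m) ≤ dist (wordMap ω v n x₀) (wordMap ω w m x₀)

/-- Separation makes the balls of radius `ρ ε` around the images of `x₀` disjoint, as stopped words
have ratio at least `rmin ε`. In `C`, the summands account for the distance from the image of `0` to
the attractor, from `x₀` to `0`, and for the ball radius. -/
theorem le_scaledVolume (hrmin : 0 < rmin) (hrmax : rmax < 1) {ω : ℕ → Systems d rmin rmax}
    {γ : ℝ} (hγ : 0 < γ) {x₀ : EuclideanSpace ℝ (Fin d)} (hsep : IsSeparated ω γ x₀) :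
    ∃ C ≥ 1, ∀ t ≥ 0, ∃ c > 0, ∀ ε, 0 < ε → ε < 1 → ∀ m,
      (∀ n, 1 ≤ n → rmin ^ n ≤ ε → ε < rmax ^ (n - 1) → m ≤ logWalk ω t n) →
      ENNReal.ofReal (c * Real.exp m) ≤ Minkowski.scaledVolume (attractor ω) t (C * ε) := by
  set κ := (volume (Metric.ball (0 : EuclideanSpace ℝ (Fin d)) 1)).toReal with hκ
  have hκ0 : 0 < κ := volume_ball_one_pos d
  set ρ := γ * rmin / 2 with hρ
  have hρ0 : 0 < ρ := by positivity
  set C := 1 + ‖x₀‖ + ρ with hC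
  have hC1 : 1 ≤ C := by have := norm_nonneg x₀; linarith
  have hC0 : 0 < C := by linarith
  refine ⟨C, hC1, fun t ht => ⟨C ^ (t - d) * ρ ^ d * κ, by positivity, fun ε h0 h1 m hm => ?_⟩⟩
  obtain ⟨T, -, hT2, hT3⟩ := exists_cut hrmin hrmax h0 h1 ω
  have hcard := (hT3 t ht m).1 hm
  have hsub : (⋃ u ∈ T, Metric.ball (wordMap ω u (cutLength ω ε u) x₀) (ρ * ε)) ⊆
      Metric.cthickening (C * ε) (attractor ω) := by
    refine Set.iUnion₂_subset fun u _ x hx => ?_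
    obtain ⟨y, hy, hyu⟩ := exists_mem_attractor u hrmin hrmax
    refine Metric.mem_cthickening_of_dist_le x y _ _ hy ?_
    have h2 := wordRatio_cutLength_le u hrmin hrmax h0
    have h3 := (hyu (cutLength ω ε u)).trans h2
    have h4 : dist (wordMap ω u (cutLength ω ε u) x₀) (wordMap ω u (cutLength ω ε u) 0) ≤ ε * ‖x₀‖ := by
      rw [dist_wordMap, dist_zero_right]
      gcongr
    have h5 := Metric.mem_ball.1 hx
    have h6 := dist_triangle4 x (wordMap ω u (cutLength ω ε u) x₀) (wordMap ω u (cutLength ω ε u) 0) y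
    rw [dist_comm (wordMap ω u (cutLength ω ε u) 0) y] at h6
    calc dist x y ≤ ρ * ε + ε * ‖x₀‖ + ε := by linarith
      _ = C * ε := by rw [hC]; ring
  have hdisj : (T : Set (Coding ω)).PairwiseDisjoint
      fun u => Metric.ball (wordMap ω u (cutLength ω ε u) x₀) (ρ * ε) := by
    intro u hu w hw huw
    refine Metric.ball_disjoint_ball ?_
    have hne : ¬ (cutLength ω ε u = cutLength ω ε w ∧ ∀ i < cutLength ω ε u, u i = w i) := fun h =>
      huw (hT2 u hu w hw fun i hi => (h.2 i hi).symm).symm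
    refine le_trans ?_ (hsep u w _ _ (one_le_cutLength u hrmin hrmax h0 h1)
      (one_le_cutLength w hrmin hrmax h0 h1) hne)
    calc ρ * ε + ρ * ε = γ * (rmin * ε) := by rw [hρ]; ring
      _ ≤ _ := by
        gcongr
        exact le_min (mul_le_wordRatio_cutLength u hrmin hrmax h0 h1)
          (mul_le_wordRatio_cutLength w hrmin hrmax h0 h1)
  have hvol : ENNReal.ofReal (T.card * ((ρ * ε) ^ d * κ)) ≤
      volume (Metric.cthickening (C * ε) (attractor ω)) := by
    refine le_trans (le_of_eq ?_) (measure_mono hsub)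
    rw [measure_biUnion_finset hdisj fun u _ => measurableSet_ball,
      Finset.sum_congr rfl fun u _ => volume_ball_eq _ (by positivity), Finset.sum_const,
      ENNReal.ofReal_mul (Nat.cast_nonneg _), nsmul_eq_mul, ENNReal.ofReal_natCast]
  rw [Minkowski.scaledVolume]
  refine le_trans ?_ (mul_le_mul_right hvol _)
  rw [← ENNReal.ofReal_mul (by positivity)]
  refine ENNReal.ofReal_le_ofReal ?_
  calc C ^ (t - d) * ρ ^ d * κ * Real.exp m ≤ C ^ (t - d) * ρ ^ d * κ * (T.card * ε ^ t) := by
        gcongr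
    _ = (C * ε) ^ (t - d) * (T.card * ((ρ * ε) ^ d * κ)) := by
        rw [Real.mul_rpow hC0.le h0.le, Real.rpow_sub h0, Real.rpow_natCast, mul_pow]
        field_simp

end RIFS

/-! ### Deterministic facts on Minkowski contents. -/

namespace Minkowski
variable {d : ℕ} {K : Set (EuclideanSpace ℝ (Fin d))}

theorem HasDim.unique {s t : ℝ} (hs : HasDim K s) (ht : HasDim K t) : s = t := by
  by_contra hne
  rcases lt_or_gt_of_ne hne with h | h
  · obtain ⟨r, h1, h2⟩ := exists_between h
    exact ENNReal.zero_ne_top (tendsto_nhds_unique (hs.2 r h1) (ht.1 r h2))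
  · obtain ⟨r, h1, h2⟩ := exists_between h
    exact ENNReal.zero_ne_top (tendsto_nhds_unique (ht.2 r h1) (hs.1 r h2))

theorem scaledVolume_anti {s t ε : ℝ} (h : s ≤ t) (h0 : 0 < ε) (h1 : ε ≤ 1) :
    scaledVolume K t ε ≤ scaledVolume K s ε :=
  mul_le_mul_left (ENNReal.ofReal_le_ofReal
    (Real.rpow_le_rpow_of_exponent_ge h0 h1 (by linarith))) _

theorem not_isMeasurable_of_upperContent_eq_top {s : ℝ} (hs : HasDim K s)
    (h : upperContent K s = ∞) : ¬ IsMeasurable K := by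
  rintro ⟨t, ht, c, -, hc, hlim⟩
  rw [← hs.unique ht] at hlim
  exact hc.ne (hlim.limsup_eq.symm.trans h)

theorem not_hasFiniteAverageContent_of_upperAverageContent_eq_top {s : ℝ}
    (h : upperAverageContent K s = ∞) : ¬ HasFiniteAverageContent K s := by
  rintro ⟨c, hc, hlim⟩
  exact hc.ne (hlim.limsup_eq.symm.trans h)

theorem lintegral_one_div {a b : ℝ} (ha : 0 < a) (hab : a ≤ b) :
    ∫⁻ ε in Set.Ioc a b, ENNReal.ofReal (1 / ε) = ENNReal.ofReal (Real.log (b / a)) := by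
  have hpos : ∀ ε ∈ Set.Ioc a b, 0 ≤ 1 / ε := fun ε hε => by
    have := ha.trans hε.1; positivity
  have hint : IntervalIntegrable (fun ε : ℝ => 1 / ε) volume a b :=
    intervalIntegral.intervalIntegrable_one_div (fun x hx => by
      rw [Set.uIcc_of_le hab] at hx; exact (ha.trans_le hx.1).ne') continuousOn_id
  rw [← ofReal_integral_eq_lintegral_ofReal
    ((intervalIntegrable_iff_integrableOn_Ioc_of_le hab).1 hint)
    ((ae_restrict_iff' measurableSet_Ioc).2 (ae_of_all _ hpos)),
    ← intervalIntegral.integral_of_le hab, integral_one_div_of_pos ha (ha.trans_le hab)]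

/-- A lower bound for the rescaled volume on an interval of scales gives a lower bound for the
logarithmic average. -/
theorem mul_log_le_logAverage {s δ b : ℝ} {A : ℝ≥0∞} (hδ : 0 < δ) (hδb : δ ≤ b) (hb : b ≤ 1)
    (hA : ∀ ε, δ < ε → ε ≤ b → A ≤ scaledVolume K s ε) :
    A * ENNReal.ofReal (Real.log (b / δ) / |Real.log δ|) ≤ logAverage K s δ := by
  rw [logAverage, div_eq_mul_one_div, mul_comm (Real.log _),
    ENNReal.ofReal_mul (by positivity), mul_left_comm]
  refine mul_le_mul_right ?_ _
  rw [← lintegral_one_div hδ hδb, ← lintegral_const_mul A (by fun_prop)]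
  calc ∫⁻ ε in Set.Ioc δ b, A * ENNReal.ofReal (1 / ε)
      ≤ ∫⁻ ε in Set.Ioc δ b, scaledVolume K s ε * ENNReal.ofReal (1 / ε) :=
        setLIntegral_mono' measurableSet_Ioc fun ε hε => mul_le_mul_left (hA ε hε.1 hε.2) _
    _ ≤ _ := lintegral_mono_set (Set.Ioc_subset_Ioc_right hb)

end Minkowski

/-! ### From the walk to the contents. -/

namespace RIFS
variable {d : ℕ} {rmin rmax : ℝ}

theorem tendsto_scaledVolume_top (hrmin : 0 < rmin) (hrmax : rmax < 1)
    {ω : ℕ → Systems d rmin rmax} {γ : ℝ} (hγ : 0 < γ) {x₀ : EuclideanSpace ℝ (Fin d)}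
    (hsep : IsSeparated ω γ x₀) {t : ℝ} (ht : 0 ≤ t) (h : Tendsto (logWalk ω t) atTop atTop) :
    Tendsto (fun ε => Minkowski.scaledVolume (attractor ω) t ε) (𝓝[>] 0) (𝓝 ∞) := by
  obtain ⟨C, hC, hC'⟩ := le_scaledVolume hrmin hrmax hγ hsep
  obtain ⟨c, hc, hc'⟩ := hC' t ht
  have hlim : Tendsto (fun m => ENNReal.ofReal (c * Real.exp m)) atTop (𝓝 ∞) :=
    ENNReal.tendsto_ofReal_nhds_top.2 (Real.tendsto_exp_atTop.const_mul_atTop hc)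
  rw [ENNReal.tendsto_nhds_top_iff_nnreal] at hlim ⊢
  intro x
  obtain ⟨m, hm⟩ := (hlim x).exists
  obtain ⟨N, hN⟩ := eventually_atTop.1 (h.eventually_ge_atTop m)
  have hC0 : 0 < C := by linarith
  -- `rmin ≤ rmax` is not a hypothesis; the existence of a single map supplies it.
  have hrm1 : rmin < 1 := by
    obtain ⟨f⟩ : Nonempty (Sim d rmin rmax) := ⟨map (ω 0) ⟨0, Nat.succ_pos _⟩⟩
    exact (f.ratio_spec.1.trans f.ratio_spec.2.1).trans_lt hrmax
  filter_upwards [Ioo_mem_nhdsGT (show 0 < C * rmin ^ N by positivity)] with ε hε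
  refine hm.trans_le ?_
  have hεC : C * (ε / C) = ε := by field_simp
  rw [← hεC]
  have hlt : ε / C < rmin ^ N := by rw [div_lt_iff₀ hC0, mul_comm]; exact hε.2
  refine hc' (ε / C) (div_pos hε.1 hC0) (hlt.trans_le (pow_le_one₀ hrmin.le hrm1.le)) m
    fun n _ hn _ => hN n ?_
  exact ((pow_lt_pow_iff_right_of_lt_one₀ hrmin hrm1).1 (hn.trans_lt hlt)).le

theorem tendsto_scaledVolume_zero (hrmin : 0 < rmin) (hrmax : rmax < 1)
    {ω : ℕ → Systems d rmin rmax} {t : ℝ} (ht : 0 ≤ t) (h : Tendsto (logWalk ω t) atTop atBot) :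
    Tendsto (fun ε => Minkowski.scaledVolume (attractor ω) t ε) (𝓝[>] 0) (𝓝 0) := by
  obtain ⟨c, hc, hc'⟩ := scaledVolume_le hrmin hrmax ω ht
  have hlim : Tendsto (fun m => ENNReal.ofReal (c * Real.exp m)) atBot (𝓝 0) := by
    simpa using ENNReal.tendsto_ofReal (Real.tendsto_exp_atBot.const_mul c)
  rw [ENNReal.tendsto_nhds_zero] at hlim ⊢
  intro x hx
  obtain ⟨m, hm⟩ := (hlim x hx).exists
  obtain ⟨N, hN⟩ := eventually_atTop.1 (h.eventually_le_atBot m)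
  have hrm1 : rmin < 1 := by
    obtain ⟨f⟩ : Nonempty (Sim d rmin rmax) := ⟨map (ω 0) ⟨0, Nat.succ_pos _⟩⟩
    exact (f.ratio_spec.1.trans f.ratio_spec.2.1).trans_lt hrmax
  filter_upwards [Ioo_mem_nhdsGT (show 0 < rmin ^ N by positivity)] with ε hε
  refine (hc' ε hε.1 (hε.2.trans_le (pow_le_one₀ hrmin.le hrm1.le)) m
    fun n _ hn _ => hN n ?_).trans hm
  exact ((pow_lt_pow_iff_right_of_lt_one₀ hrmin hrm1).1 (hn.trans_lt hε.2)).le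

/-- If the walk at exponent `s` is arbitrarily large during arbitrarily late windows `[n, 2 q n]`,
where `rmax ^ q ≤ rmin`, then the upper and the upper average Minkowski contents are infinite. -/
theorem contents_eq_top_of_frequently_window (hrmin : 0 < rmin) (hrmax : rmax < 1)
    {ω : ℕ → Systems d rmin rmax} {γ : ℝ} (hγ : 0 < γ) {x₀ : EuclideanSpace ℝ (Fin d)}
    (hsep : IsSeparated ω γ x₀) {s : ℝ} (hs : 0 ≤ s) {q : ℕ} (hq : rmax ^ q ≤ rmin)
    (h : ∀ M : ℝ, ∃ᶠ n : ℕ in atTop, ∀ k, n ≤ k → k ≤ 2 * q * n → M ≤ logWalk ω s k) :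
    Minkowski.upperContent (attractor ω) s = ∞ ∧
      Minkowski.upperAverageContent (attractor ω) s = ∞ := by
  obtain ⟨C, hC, hC'⟩ := le_scaledVolume hrmin hrmax hγ hsep
  obtain ⟨c, hc, hc'⟩ := hC' s hs
  have hC0 : 0 < C := by linarith
  have hr : rmin ≤ rmax := by
    obtain ⟨f⟩ : Nonempty (Sim d rmin rmax) := ⟨map (ω 0) ⟨0, Nat.succ_pos _⟩⟩
    exact f.ratio_spec.1.trans f.ratio_spec.2.1
  have hrm1 : rmin < 1 := hr.trans_lt hrmax
  have hrmax0 : 0 < rmax := hrmin.trans_le hr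
  have hpow : Tendsto (fun n : ℕ => C * rmin ^ n) atTop (𝓝[>] 0) := by
    refine tendsto_nhdsWithin_iff.2 ⟨?_, Eventually.of_forall fun n => by
      simp only [Set.mem_Ioi]; positivity⟩
    simpa using (tendsto_pow_atTop_nhds_zero_of_lt_one hrmin.le hrm1).const_mul C
  have hwin : ∀ M : ℝ, ∃ᶠ n : ℕ in atTop, ∀ ε, C * rmin ^ (2 * n) ≤ ε → ε ≤ C * rmin ^ n →
      ENNReal.ofReal (c * Real.exp M) ≤ Minkowski.scaledVolume (attractor ω) s ε := by
    intro M
    refine ((h M).and_eventually (eventually_ge_atTop 1)).mono ?_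
    rintro n ⟨hn, hn1⟩ ε hε1 hε2
    have hεC : C * (ε / C) = ε := by field_simp
    have h1 : rmin ^ (2 * n) ≤ ε / C := by rw [le_div_iff₀ hC0, mul_comm]; exact hε1
    have h2 : ε / C ≤ rmin ^ n := by rw [div_le_iff₀ hC0, mul_comm]; exact hε2
    rw [← hεC]
    refine hc' (ε / C) (lt_of_lt_of_le (by positivity) h1)
      (h2.trans_lt (pow_lt_one₀ hrmin.le hrm1 (by omega))) M fun k _ hk1 hk2 => hn k ?_ ?_
    · exact (pow_le_pow_iff_right_of_lt_one₀ hrmin hrm1).1 (hk1.trans h2)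
    -- `rmax ^ (2 q n) ≤ rmin ^ (2 n) ≤ ε / C < rmax ^ (k - 1)` forces `k ≤ 2 q n`.
    · have h3 : rmax ^ (q * (2 * n)) < rmax ^ (k - 1) := by
        rw [pow_mul]
        exact ((pow_le_pow_left₀ (by positivity) hq _).trans h1).trans_lt hk2
      have h4 := (pow_lt_pow_iff_right_of_lt_one₀ hrmax0 hrmax).1 h3
      have h5 : q * (2 * n) = 2 * q * n := by ring
      omega
  have htop : ∀ {a : ℝ≥0∞} {b : ℝ}, 0 < b → (∀ M : ℝ,
      ENNReal.ofReal (c * Real.exp M) * ENNReal.ofReal b ≤ a) → a = ∞ := by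
    intro a b hb ha
    have hlim : Tendsto (fun m => ENNReal.ofReal (c * Real.exp m * b)) atTop (𝓝 ∞) :=
      ENNReal.tendsto_ofReal_nhds_top.2
        ((Real.tendsto_exp_atTop.const_mul_atTop hc).atTop_mul_const hb)
    refine top_le_iff.1 (le_of_tendsto' hlim fun M => ?_)
    rw [ENNReal.ofReal_mul (by positivity)]
    exact ha M
  constructor
  · refine htop one_pos fun M => ?_
    rw [ENNReal.ofReal_one, mul_one]
    refine le_limsup_of_frequently_le (hpow.frequently ((hwin M).mono fun n hn => ?_))
    refine hn _ ?_ le_rfl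
    exact mul_le_mul_of_nonneg_left
      (pow_le_pow_of_le_one hrmin.le hrm1.le (Nat.le_mul_of_pos_left n two_pos)) hC0.le
  -- With `δ = C rmin ^ (2 n)` the good scales have logarithmic length `n |log rmin|`, while `|log
  -- δ| ≤ 2 n |log rmin|` because `C ≥ 1`.
  · refine htop (b := 1 / 2) (by norm_num) fun M => ?_
    have hpow2 : Tendsto (fun n : ℕ => C * rmin ^ (2 * n)) atTop (𝓝[>] 0) :=
      hpow.comp (tendsto_id.const_mul_atTop' two_pos)
    refine le_limsup_of_frequently_le (hpow2.frequently ?_)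
    have hsmall : ∀ᶠ n in atTop, C * rmin ^ n ∈ Set.Ioo 0 1 :=
      hpow.eventually (Ioo_mem_nhdsGT one_pos)
    refine (((hwin M).and_eventually hsmall).and_eventually (eventually_ge_atTop 1)).mono ?_
    rintro n ⟨⟨hn, -, hn1⟩, hn0⟩
    have hle : C * rmin ^ (2 * n) ≤ C * rmin ^ n := by
      gcongr C * ?_
      exact pow_le_pow_of_le_one hrmin.le hrm1.le (by omega)
    refine le_trans ?_ (Minkowski.mul_log_le_logAverage (by positivity) hle hn1.le
      fun ε h1 h2 => hn ε h1.le h2)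
    refine mul_le_mul_right (ENNReal.ofReal_le_ofReal ?_) _
    have hlog : Real.log rmin < 0 := Real.log_neg hrmin hrm1
    have hlogC : 0 ≤ Real.log C := Real.log_nonneg hC
    have hn0' : (1 : ℝ) ≤ n := by exact_mod_cast hn0
    have e1 : Real.log (C * rmin ^ n / (C * rmin ^ (2 * n))) = -(n * Real.log rmin) := by
      rw [Real.log_div (by positivity) (by positivity), Real.log_mul (by positivity) (by positivity),
        Real.log_mul (by positivity) (by positivity), Real.log_pow, Real.log_pow]
      push_cast
      ring
    have hneg : Real.log (C * rmin ^ (2 * n)) < 0 :=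
      Real.log_neg (by positivity) (hle.trans_lt hn1)
    rw [e1, abs_of_neg hneg, le_div_iff₀ (by linarith),
      Real.log_mul (by positivity) (by positivity), Real.log_pow]
    push_cast
    nlinarith

end RIFS

/-! ### The pressure and its zero. -/

namespace RIFS
variable {d : ℕ} {rmin rmax : ℝ}

/-- For `d ≥ 1` the chosen ratio is a quotient of distances at two fixed distinct points, hence
continuous in the map. -/
theorem measurable_ratio (hd : 0 < d) : Measurable (Sim.ratio : Sim d rmin rmax → ℝ) := by
  have : Nonempty (Fin d) := ⟨⟨0, hd⟩⟩
  obtain ⟨x, y, hxy⟩ := exists_pair_ne (EuclideanSpace ℝ (Fin d))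
  have heq : (Sim.ratio : Sim d rmin rmax → ℝ) = fun f => dist (f.1 x) (f.1 y) / dist x y := by
    ext f
    rw [Sim.dist_eq, mul_div_cancel_right₀ _ (dist_ne_zero.2 hxy)]
  have heval : ∀ z, Continuous fun f : Sim d rmin rmax => f.1 z := fun z =>
    (continuous_apply z).comp continuous_subtype_val
  rw [heq]
  exact (((heval x).dist (heval y)).div_const _).measurable

theorem measurable_sigma {ι : Type*} {β : ι → Type*} {γ : Type*} [∀ i, MeasurableSpace (β i)]
    [MeasurableSpace γ] {f : (Σ i, β i) → γ} (h : ∀ i, Measurable fun x => f ⟨i, x⟩) :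
    Measurable f := fun _ hs => MeasurableSpace.measurableSet_iInf.2 fun i => h i hs

theorem measurable_hutchinsonSum (hd : 0 < d) (t : ℝ) :
    Measurable fun l : Systems d rmin rmax => hutchinsonSum l t :=
  measurable_sigma fun k => Finset.measurable_fun_sum Finset.univ fun (i : Fin (k + 1)) _ =>
    ((measurable_ratio hd).comp
      (measurable_pi_apply (X := fun _ : Fin (k + 1) => Sim d rmin rmax) i)).pow_const t

theorem measurable_log_hutchinsonSum (hd : 0 < d) (t : ℝ) :
    Measurable fun l : Systems d rmin rmax => Real.log (hutchinsonSum l t) :=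
  Real.measurable_log.comp (measurable_hutchinsonSum hd t)

theorem mul_log_le_log_hutchinsonSum (hrmin : 0 < rmin) (l : Systems d rmin rmax) {t : ℝ}
    (ht : 0 ≤ t) : t * Real.log rmin ≤ Real.log (hutchinsonSum l t) := by
  rw [← Real.log_rpow hrmin]
  refine Real.log_le_log (Real.rpow_pos_of_pos hrmin t) ?_
  let i : Fin (numMaps l) := ⟨0, Nat.succ_pos _⟩
  exact (Real.rpow_le_rpow hrmin.le (map l i).ratio_spec.1 ht).trans
    (Finset.single_le_sum (f := fun i => (map l i).ratio ^ t)
      (fun j _ => Real.rpow_nonneg ((map l j).ratio_pos hrmin).le t) (Finset.mem_univ i))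

theorem log_hutchinsonSum_le (hrmin : 0 < rmin) (l : Systems d rmin rmax) {N : ℕ}
    (hl : numMaps l ≤ N) {t : ℝ} (ht : 0 ≤ t) :
    Real.log (hutchinsonSum l t) ≤ Real.log N + t * Real.log rmax := by
  have hmax : 0 < rmax := hrmin.trans_le
    ((map l ⟨0, Nat.succ_pos _⟩).ratio_spec.1.trans (map l ⟨0, Nat.succ_pos _⟩).ratio_spec.2.1)
  have hN : (0 : ℝ) < N := by exact_mod_cast (Nat.succ_pos _).trans_le hl
  rw [← Real.log_rpow hmax, ← Real.log_mul hN.ne' (Real.rpow_pos_of_pos hmax t).ne']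
  refine Real.log_le_log (hutchinsonSum_pos hrmin l t) ?_
  calc hutchinsonSum l t ≤ ∑ _i : Fin (numMaps l), rmax ^ t :=
        Finset.sum_le_sum fun i _ => Real.rpow_le_rpow ((map l i).ratio_pos hrmin).le
          (map l i).ratio_spec.2.1 ht
    _ = numMaps l * rmax ^ t := by simp
    _ ≤ N * rmax ^ t := by gcongr

/-- Termwise `r ^ t = r ^ u * r ^ (t - u)` with `t - u ≤ 0`. This yields strict decrease of the
pressure; the companion bound with `rmin` yields its continuity. -/
theorem log_hutchinsonSum_add_le (hrmin : 0 < rmin) (l : Systems d rmin rmax) {t u : ℝ}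
    (h : t ≤ u) :
    Real.log (hutchinsonSum l u) + (u - t) * -Real.log rmax ≤ Real.log (hutchinsonSum l t) := by
  have hmax : 0 < rmax := hrmin.trans_le
    ((map l ⟨0, Nat.succ_pos _⟩).ratio_spec.1.trans (map l ⟨0, Nat.succ_pos _⟩).ratio_spec.2.1)
  rw [show (u - t) * -Real.log rmax = (t - u) * Real.log rmax by ring, ← Real.log_rpow hmax,
    ← Real.log_mul (hutchinsonSum_pos hrmin l u).ne' (Real.rpow_pos_of_pos hmax _).ne']
  refine Real.log_le_log (mul_pos (hutchinsonSum_pos hrmin l u) (Real.rpow_pos_of_pos hmax _)) ?_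
  rw [hutchinsonSum, Finset.sum_mul]
  refine Finset.sum_le_sum fun i _ => ?_
  have hi := (map l i).ratio_pos hrmin
  rw [show (map l i).ratio ^ t = (map l i).ratio ^ u * (map l i).ratio ^ (t - u) by
    rw [← Real.rpow_add hi]; ring_nf]
  exact mul_le_mul_of_nonneg_left (Real.rpow_le_rpow_of_nonpos hi (map l i).ratio_spec.2.1
    (by linarith)) (Real.rpow_nonneg hi.le _)

theorem log_hutchinsonSum_le_add (hrmin : 0 < rmin) (l : Systems d rmin rmax) {t u : ℝ}
    (h : t ≤ u) :
    Real.log (hutchinsonSum l t) ≤ Real.log (hutchinsonSum l u) + (u - t) * -Real.log rmin := by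
  rw [show (u - t) * -Real.log rmin = (t - u) * Real.log rmin by ring, ← Real.log_rpow hrmin,
    ← Real.log_mul (hutchinsonSum_pos hrmin l u).ne' (Real.rpow_pos_of_pos hrmin _).ne']
  refine Real.log_le_log (hutchinsonSum_pos hrmin l t) ?_
  rw [hutchinsonSum, hutchinsonSum, Finset.sum_mul]
  refine Finset.sum_le_sum fun i _ => ?_
  have hi := (map l i).ratio_pos hrmin
  rw [show (map l i).ratio ^ t = (map l i).ratio ^ u * (map l i).ratio ^ (t - u) by
    rw [← Real.rpow_add hi]; ring_nf]
  exact mul_le_mul_of_nonneg_left (Real.rpow_le_rpow_of_nonpos hrmin (map l i).ratio_spec.1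
    (by linarith)) (Real.rpow_nonneg hi.le _)

section Pressure

variable (P₁ : Measure (Systems d rmin rmax))

/-- The expected logarithm of the Hutchinson sum. -/
noncomputable def pressure (t : ℝ) : ℝ := ∫ l, Real.log (hutchinsonSum l t) ∂P₁

variable {P₁}

theorem exists_ae_numMaps_le (hN : essSupNumMaps P₁ < ⊤) :
    ∃ N : ℕ, ∀ᵐ l ∂P₁, numMaps l ≤ N := by
  obtain ⟨N, hN'⟩ := ENat.ne_top_iff_exists.1 hN.ne
  refine ⟨N, ?_⟩
  filter_upwards [ae_le_essSup (f := fun l : Systems d rmin rmax => (numMaps l : ℕ∞)) (μ := P₁)]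
    with l hl
  have : (numMaps l : ℕ∞) ≤ N := hN' ▸ hl
  exact_mod_cast this

theorem not_ae_numMaps_le_one (hN₂ : 2 ≤ essSupNumMaps P₁) : ¬ ∀ᵐ l ∂P₁, numMaps l ≤ 1 := by
  intro h
  have : essSupNumMaps P₁ ≤ 1 := essSup_le_of_ae_le 1 (h.mono fun l hl => by
    change (numMaps l : ℕ∞) ≤ 1
    exact_mod_cast hl)
  exact absurd (hN₂.trans this) (by norm_num)

variable [IsProbabilityMeasure P₁] (hrmin : 0 < rmin) (hrmax : rmax < 1) (hd : 0 < d) {N : ℕ}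
  (hN : ∀ᵐ l ∂P₁, numMaps l ≤ N)
include hrmin hd hN

theorem memLp_log_hutchinsonSum {t : ℝ} (ht : 0 ≤ t) (p : ℝ≥0∞) :
    MemLp (fun l => Real.log (hutchinsonSum l t)) p P₁ := by
  refine MemLp.of_bound (measurable_log_hutchinsonSum hd t).aestronglyMeasurable
    (max |t * Real.log rmin| |Real.log N + t * Real.log rmax|) ?_
  filter_upwards [hN] with l hl
  exact abs_le_max_abs_abs (mul_log_le_log_hutchinsonSum hrmin l ht)
    (log_hutchinsonSum_le hrmin l hl ht)

theorem integrable_log_hutchinsonSum {t : ℝ} (ht : 0 ≤ t) :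
    Integrable (fun l => Real.log (hutchinsonSum l t)) P₁ :=
  memLp_one_iff_integrable.1 (memLp_log_hutchinsonSum hrmin hd hN ht 1)

theorem pressure_add_le {t u : ℝ} (ht : 0 ≤ t) (h : t ≤ u) :
    pressure P₁ u + (u - t) * -Real.log rmax ≤ pressure P₁ t := by
  have hu := integrable_log_hutchinsonSum hrmin hd hN (ht.trans h)
  have := integral_mono (hu.add (integrable_const ((u - t) * -Real.log rmax)))
    (integrable_log_hutchinsonSum hrmin hd hN ht)
    fun l => log_hutchinsonSum_add_le hrmin l h
  simp only [Pi.add_apply] at this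
  rw [integral_add hu (integrable_const _)] at this
  simpa [pressure] using this

theorem pressure_le_add {t u : ℝ} (ht : 0 ≤ t) (h : t ≤ u) :
    pressure P₁ t ≤ pressure P₁ u + (u - t) * -Real.log rmin := by
  have hu := integrable_log_hutchinsonSum hrmin hd hN (ht.trans h)
  have := integral_mono (integrable_log_hutchinsonSum hrmin hd hN ht)
    (hu.add (integrable_const ((u - t) * -Real.log rmin)))
    fun l => log_hutchinsonSum_le_add hrmin l h
  simp only [Pi.add_apply] at this
  rw [integral_add hu (integrable_const _)] at this
  simpa [pressure] using this

/-- At exponent 0 the sum counts the maps, so zero expectation would force a single map almost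
surely. -/
theorem pressure_zero_pos (hN₂ : 2 ≤ essSupNumMaps P₁) :
    0 < pressure P₁ 0 := by
  have h0 : ∀ l : Systems d rmin rmax, hutchinsonSum l 0 = numMaps l := fun l => by
    simp [hutchinsonSum]
  have hnn : 0 ≤ fun l : Systems d rmin rmax => Real.log (hutchinsonSum l 0) := fun l => by
    simp only [h0]
    exact Real.log_natCast_nonneg _
  refine lt_of_le_of_ne (integral_nonneg hnn) fun h => not_ae_numMaps_le_one hN₂ ?_
  have := (integral_eq_zero_iff_of_nonneg hnn
    (integrable_log_hutchinsonSum hrmin hd hN le_rfl)).1 h.symm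
  filter_upwards [this] with l hl
  have h1 : hutchinsonSum l 0 = 1 :=
    Real.eq_one_of_pos_of_log_eq_zero (hutchinsonSum_pos hrmin l 0) hl
  rw [h0] at h1
  exact_mod_cast h1.le

include hrmax

theorem exists_pressure_eq_zero (hN₂ : 2 ≤ essSupNumMaps P₁) :
    ∃ s, 0 < s ∧ pressure P₁ s = 0 ∧ (∀ t, 0 ≤ t → t < s → 0 < pressure P₁ t) ∧
      ∀ t, s < t → pressure P₁ t < 0 := by
  obtain ⟨l⟩ : Nonempty (Systems d rmin rmax) := P₁.nonempty_of_neZero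
  have hr : rmin ≤ rmax :=
    (map l ⟨0, Nat.succ_pos _⟩).ratio_spec.1.trans (map l ⟨0, Nat.succ_pos _⟩).ratio_spec.2.1
  have hlog : 0 < -Real.log rmax := neg_pos.2 (Real.log_neg (hrmin.trans_le hr) hrmax)
  have hlog' : 0 < -Real.log rmin := neg_pos.2 (Real.log_neg hrmin (hr.trans_lt hrmax))
  have hpos : 0 < pressure P₁ 0 := pressure_zero_pos hrmin hd hN hN₂
  have hlip : LipschitzOnWith (-Real.log rmin).toNNReal (pressure P₁) (Set.Ici 0) := by
    refine LipschitzOnWith.of_dist_le_mul fun t ht u hu => ?_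
    rw [Real.coe_toNNReal _ hlog'.le]
    wlog h : t ≤ u generalizing t u
    · rw [dist_comm, dist_comm t]
      exact this u hu t ht (le_of_not_ge h)
    have h1 := pressure_add_le hrmin hd hN (Set.mem_Ici.1 ht) h
    have h2 := pressure_le_add hrmin hd hN (Set.mem_Ici.1 ht) h
    have h3 : 0 ≤ (u - t) * -Real.log rmax := mul_nonneg (by linarith) hlog.le
    rw [Real.dist_eq, Real.dist_eq, abs_of_nonneg (by linarith), abs_sub_comm,
      abs_of_nonneg (by linarith : 0 ≤ u - t)]
    linarith
  -- By this exponent the minimal rate of decrease `-log rmax` has used up the pressure at 0.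
  set T := pressure P₁ 0 / -Real.log rmax with hT
  have hT0 : 0 ≤ T := by positivity
  have hTneg : pressure P₁ T ≤ 0 := by
    have h1 := pressure_add_le hrmin hd hN le_rfl hT0
    rw [sub_zero, show T * -Real.log rmax = pressure P₁ 0 from div_mul_cancel₀ _ hlog.ne'] at h1
    linarith
  obtain ⟨s, hs, hs0⟩ := intermediate_value_Icc' hT0
    (hlip.continuousOn.mono fun x hx => hx.1) ⟨hTneg, hpos.le⟩
  have hspos : 0 < s := lt_of_le_of_ne hs.1 fun h => by
    rw [← h] at hs0
    exact hpos.ne' hs0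
  refine ⟨s, hspos, hs0, fun t ht hts => ?_, fun t hst => ?_⟩
  · have h1 := pressure_add_le hrmin hd hN ht hts.le
    have h2 : 0 < (s - t) * -Real.log rmax := mul_pos (by linarith) hlog
    linarith
  · have h1 := pressure_add_le hrmin hd hN hspos.le hst.le
    have h2 : 0 < (t - s) * -Real.log rmax := mul_pos (by linarith) hlog
    linarith

end Pressure

/-! ### Almost sure statements under the product law. -/

section Law

open ProbabilityTheory

variable (P₁ : Measure (Systems d rmin rmax)) [IsProbabilityMeasure P₁]

theorem identDistrib_eval {f : Systems d rmin rmax → ℝ} (hf : Measurable f) (i : ℕ) :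
    IdentDistrib (fun ω : ℕ → Systems d rmin rmax => f (ω i)) f (law P₁) P₁ where
  aemeasurable_fst := (hf.comp (measurable_pi_apply i)).aemeasurable
  aemeasurable_snd := hf.aemeasurable
  map_eq := by
    have := (measurePreserving_eval_infinitePi (fun _ : ℕ => P₁) i).map_eq
    calc Measure.map (f ∘ Function.eval i) (law P₁)
        = Measure.map f (Measure.map (Function.eval i) (law P₁)) :=
          (Measure.map_map hf (measurable_pi_apply i)).symm
      _ = Measure.map f P₁ := by rw [this]

variable {P₁}

theorem tendsto_atTop_of_tendsto_div_natCast {u : ℕ → ℝ} {a : ℝ} (ha : 0 < a)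
    (h : Tendsto (fun n : ℕ => u n / n) atTop (𝓝 a)) : Tendsto u atTop atTop := by
  refine (h.pos_mul_atTop ha tendsto_natCast_atTop_atTop).congr' ?_
  filter_upwards [eventually_gt_atTop 0] with n hn
  have : (n : ℝ) ≠ 0 := by exact_mod_cast hn.ne'
  field_simp

theorem ae_tendsto_logWalk_div (hrmin : 0 < rmin) (hd : 0 < d) {N : ℕ}
    (hN : ∀ᵐ l ∂P₁, numMaps l ≤ N) {t : ℝ} (ht : 0 ≤ t) :
    ∀ᵐ ω ∂law P₁, Tendsto (fun n : ℕ => logWalk ω t n / n) atTop (𝓝 (pressure P₁ t)) := by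
  have hm := measurable_log_hutchinsonSum (rmin := rmin) (rmax := rmax) hd t
  have hid := identDistrib_eval P₁ hm
  have hind := iIndepFun_infinitePi (P := fun _ : ℕ => P₁) (X := fun _ l =>
    Real.log (hutchinsonSum l t)) fun _ => hm
  have := strong_law_ae_real (μ := law P₁) (fun i ω => Real.log (hutchinsonSum (ω i) t))
    ((hid 0).integrable_iff.2 (integrable_log_hutchinsonSum hrmin hd hN ht))
    (fun i j hij => hind.indepFun hij) fun i => (hid i).trans (hid 0).symm
  rw [(hid 0).integral_eq] at this
  exact this

/-- The strong law at all rational exponents costs one null set; monotonicity in the exponent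
reaches the real ones, including negative `t`. -/
theorem ae_hasDim (hrmin : 0 < rmin) (hrmax : rmax < 1) (hd : 0 < d) {N : ℕ}
    (hN : ∀ᵐ l ∂P₁, numMaps l ≤ N) {γ : ℝ} (hγ : 0 < γ) {x₀ : EuclideanSpace ℝ (Fin d)}
    (hsep : ∀ᵐ ω ∂law P₁, IsSeparated ω γ x₀) {s : ℝ} (hs : 0 < s)
    (hlt : ∀ t, 0 ≤ t → t < s → 0 < pressure P₁ t) (hgt : ∀ t, s < t → pressure P₁ t < 0) :
    ∀ᵐ ω ∂law P₁, Minkowski.HasDim (attractor ω) s := by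
  have hslln : ∀ᵐ ω ∂law P₁, ∀ q : ℚ, 0 ≤ (q : ℝ) →
      Tendsto (fun n : ℕ => logWalk ω q n / n) atTop (𝓝 (pressure P₁ q)) := by
    rw [ae_all_iff]
    intro q
    by_cases hq : 0 ≤ (q : ℝ)
    · filter_upwards [ae_tendsto_logWalk_div hrmin hd hN hq] with ω hω _ using hω
    · exact ae_of_all _ fun ω h => absurd h hq
  have hev : ∀ᶠ ε : ℝ in 𝓝[>] 0, 0 < ε ∧ ε ≤ 1 :=
    (Ioc_mem_nhdsGT one_pos : Set.Ioc (0 : ℝ) 1 ∈ 𝓝[>] 0)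
  filter_upwards [hsep, hslln] with ω hω hlim
  constructor
  · intro t ht
    obtain ⟨q, hq1, hq2⟩ := exists_rat_btwn (max_lt ht hs)
    have hq0 : 0 ≤ (q : ℝ) := (le_max_right _ _).trans hq1.le
    refine tendsto_nhds_top_mono (tendsto_scaledVolume_top hrmin hrmax hγ hω hq0
      (tendsto_atTop_of_tendsto_div_natCast (hlt q hq0 hq2) (hlim q hq0))) ?_
    filter_upwards [hev] with ε hε
    exact Minkowski.scaledVolume_anti ((le_max_left _ _).trans hq1.le) hε.1 hε.2
  · intro t ht
    obtain ⟨q, hq1, hq2⟩ := exists_rat_btwn ht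
    have hq0 : 0 ≤ (q : ℝ) := hs.le.trans hq1.le
    have hneg : Tendsto (logWalk ω q) atTop atBot := by
      refine tendsto_neg_atTop_iff.1 (tendsto_atTop_of_tendsto_div_natCast (neg_pos.2 (hgt q hq1)) ?_)
      simpa [neg_div] using (hlim q hq0).neg
    refine tendsto_of_tendsto_of_tendsto_of_le_of_le' tendsto_const_nhds
      (tendsto_scaledVolume_zero hrmin hrmax hq0 hneg) (Eventually.of_forall fun _ => zero_le) ?_
    filter_upwards [hev] with ε hε
    exact Minkowski.scaledVolume_anti hq2.le hε.1 hε.2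

theorem ae_frequently_window_logWalk (hrmin : 0 < rmin) (hd : 0 < d) {N : ℕ}
    (hN : ∀ᵐ l ∂P₁, numMaps l ≤ N) (hdet : ¬ AlmostDeterministic P₁) {s : ℝ} (hs : 0 ≤ s)
    (h0 : pressure P₁ s = 0) (K : ℕ) :
    ∀ᵐ ω ∂law P₁, ∀ M : ℝ, ∃ᶠ n : ℕ in atTop, ∀ k, n ≤ k → k ≤ K * n → M ≤ logWalk ω s k := by
  have hm := measurable_log_hutchinsonSum (rmin := rmin) (rmax := rmax) hd s
  have hid := identDistrib_eval P₁ hm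
  have hLp := memLp_log_hutchinsonSum hrmin hd hN hs 2
  refine RandomWalk.ae_frequently_window
    (X := fun i (ω : ℕ → Systems d rmin rmax) => Real.log (hutchinsonSum (ω i) s))
    (fun i => hm.comp (measurable_pi_apply i)) ((hid 0).memLp_iff.2 hLp)
    (iIndepFun_infinitePi (P := fun _ : ℕ => P₁) (X := fun _ l => Real.log (hutchinsonSum l s))
      fun _ => hm) (fun i => (hid i).trans (hid 0).symm) ((hid 0).integral_eq.trans h0) ?_ K
  rw [(hid 0).variance_eq]
  -- Zero variance makes the log Hutchinson sum almost surely equal to its mean 0, so the system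
  -- would be almost deterministic.
  intro hvar
  refine hdet ⟨s, ?_⟩
  filter_upwards [ae_eq_integral_of_variance_eq_zero hLp hvar] with l hl
  exact Real.eq_one_of_pos_of_log_eq_zero (hutchinsonSum_pos hrmin l s) (hl.trans h0)

/-- In dimension 0 all points coincide, which contradicts separation of two words of different
lengths. -/
theorem pos_dim_of_uniformCylinderSeparation (hrmin : 0 < rmin)
    (hsep : UniformCylinderSeparation P₁) : 0 < d := by
  rcases Nat.eq_zero_or_pos d with rfl | h
  · obtain ⟨γ, hγ, x₀, h⟩ := hsep
    obtain ⟨ω, hω⟩ := h.exists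
    let v : Coding ω := fun _ => ⟨0, Nat.succ_pos _⟩
    have h1 := hω v v 1 2 le_rfl one_le_two (by norm_num)
    rw [Subsingleton.elim (wordMap ω v 1 x₀) (wordMap ω v 2 x₀), dist_self] at h1
    exact absurd h1 (not_le.2 (mul_pos hγ (lt_min (wordRatio_pos v hrmin 1)
      (wordRatio_pos v hrmin 2))))
  · exact h

end Law

end RIFS

theorem theorem1 {d : ℕ} {rmin rmax : ℝ} (hrmin : 0 < rmin) (hrmax : rmax < 1)
    (P₁ : Measure (RIFS.Systems d rmin rmax)) [IsProbabilityMeasure P₁]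
    (hsep : RIFS.UniformCylinderSeparation P₁)
    (hdet : ¬ RIFS.AlmostDeterministic P₁)
    (hN₂ : 2 ≤ RIFS.essSupNumMaps P₁) (hN : RIFS.essSupNumMaps P₁ < ⊤) :
    (∃ s : ℝ, ∀ᵐ ω ∂(RIFS.law P₁), Minkowski.HasDim (RIFS.attractor ω) s) ∧
    ∀ s : ℝ, (∀ᵐ ω ∂(RIFS.law P₁), Minkowski.HasDim (RIFS.attractor ω) s) →
      ∀ᵐ ω ∂(RIFS.law P₁),
        Minkowski.upperContent (RIFS.attractor ω) s = ∞ ∧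
        Minkowski.upperAverageContent (RIFS.attractor ω) s = ∞ ∧
        ¬ Minkowski.IsMeasurable (RIFS.attractor ω) ∧
        ¬ Minkowski.HasFiniteAverageContent (RIFS.attractor ω) s := by
  have hd := RIFS.pos_dim_of_uniformCylinderSeparation hrmin hsep
  obtain ⟨N, hN'⟩ := RIFS.exists_ae_numMaps_le hN
  obtain ⟨γ, hγ, x₀, hsep'⟩ := hsep
  obtain ⟨s, hs, hs0, hlt, hgt⟩ := RIFS.exists_pressure_eq_zero hrmin hrmax hd hN' hN₂
  have hdim := RIFS.ae_hasDim hrmin hrmax hd hN' hγ hsep' hs hlt hgt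
  refine ⟨⟨s, hdim⟩, fun t ht => ?_⟩
  -- Two almost sure dimensions are attained at a common `ω`, hence agree.
  obtain ⟨ω, h1, h2⟩ := (hdim.and ht).exists
  obtain rfl := h1.unique h2
  obtain ⟨q, hq⟩ := exists_pow_lt_of_lt_one hrmin hrmax
  filter_upwards [hdim, hsep',
    RIFS.ae_frequently_window_logWalk hrmin hd hN' hdet hs.le hs0 (2 * q)] with ω hω hsepω hwin
  obtain ⟨h3, h4⟩ :=
    RIFS.contents_eq_top_of_frequently_window hrmin hrmax hγ hsepω hs.le hq.le hwin
  exact ⟨h3, h4, Minkowski.not_isMeasurable_of_upperContent_eq_top hω h3,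
    Minkowski.not_hasFiniteAverageContent_of_upperAverageContent_eq_top h4⟩
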